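/- Let $\rho_1,\rho_2,\rho_3\in(0,1)$ with $\rho_1+\rho_2+\rho_3<1$, and let $d_2$ be any real number with $\rho_1<d_2<1-\rho_2-\rho_3$. Let $M_\rho\subset\mathbb R$ be the attractor of the iterated function system $$\Phi_1(x)=\rho_1x,\qquad \Phi_2(x)=\rho_2x+d_2,\qquad \Phi_3(x)=\rho_3x+1-\rho_3,$$ that is, the unique nonempty compact set $E$ with $E=\bigcup_{i=1}^3\Phi_i(E)$, and let $M'_\rho\subset\mathbb R$ be the attractor of $$\Psi_1(x)=\rho_1x,\qquad \Psi_2(x)=\rho_2x+1-\rho_2-\rho_3,\qquad \Psi_3(x)=\rho_3x+1-\rho_3.$$ (So the intervals $\Phi_i([0,1])$ are pairwise disjoint, whereas $\Psi_2([0,1])$ and $\Psi_3([0,1])$ share an endpoint.) Then $M_\rho$ and $M'_\rho$ are Lipschitz equivalent, i.e. there are a bijection $f:M_\rho\to M'_\rho$ and constants $c,c'>0$ with $c|x-y|\le|f(x)-f(y)|\le c'|x-y|$ for all $x,y\in M_\rho$, if and only if $\log\rho_1/\log\rho_3\in\mathbb Q$. -/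

import Mathlib

/-- Two subsets of a metric space are Lipschitz equivalent if there is a bi-Lipschitz bijection
between them. -/
def LipschitzEquivalent {X : Type*} [MetricSpace X] (E F : Set X) : Prop :=
  ∃ f : E ≃ F, ∃ c > (0 : ℝ), ∃ c' > (0 : ℝ), ∀ x y : E,
    c * dist x y ≤ dist (f x) (f y) ∧ dist (f x) (f y) ≤ c' * dist x y

/-- A family of similitudes of `X` with contraction ratios in `(0, 1)`. -/
structure SimilitudeIFS (ι X : Type*) [MetricSpace X] where
  map : ι → X → X
  ratio : ι → ℝ
  ratio_pos : ∀ i, 0 < ratio i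
  ratio_lt_one : ∀ i, ratio i < 1
  dist_map : ∀ i x y, dist (map i x) (map i y) = ratio i * dist x y

namespace SimilitudeIFS

variable {ι X : Type*} [MetricSpace X]

/-- `E` is a nonempty compact set with `⋃ i, S i (E) = E`. -/
def IsAttractor (S : SimilitudeIFS ι X) (E : Set X) : Prop :=
  E.Nonempty ∧ IsCompact E ∧ ⋃ i, S.map i '' E = E

theorem lipschitzWith (S : SimilitudeIFS ι X) (i : ι) :
    LipschitzWith (S.ratio i).toNNReal (S.map i) :=
  LipschitzWith.of_dist_le_mul fun x y => by
    rw [S.dist_map, Real.coe_toNNReal _ (S.ratio_pos i).le]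

/-- Every finite nonempty family of contracting similitudes of a complete metric space has exactly
one attractor. -/
theorem existsUnique_isAttractor [Fintype ι] [Nonempty ι] [CompleteSpace X] [Nonempty X]
    (S : SimilitudeIFS ι X) : ∃! E : Set X, S.IsAttractor E := by
  let K : NNReal := Finset.univ.sup fun i => (S.ratio i).toNNReal
  have hK : K < 1 := (Finset.sup_lt_iff (by simp)).2 fun i _ =>
    Real.toNNReal_lt_one.2 (S.ratio_lt_one i)
  have hL : ∀ i, LipschitzWith K (S.map i) := fun i =>
    (S.lipschitzWith i).weaken
      (Finset.le_sup (f := fun i => (S.ratio i).toNNReal) (Finset.mem_univ i))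
  let H : TopologicalSpace.NonemptyCompacts X → TopologicalSpace.NonemptyCompacts X := fun A =>
    ⟨⟨⋃ i, S.map i '' A, isCompact_iUnion fun i => A.isCompact.image (hL i).continuous⟩,
      Set.nonempty_iUnion.2 ⟨Classical.arbitrary ι, A.nonempty.image _⟩⟩
  have hH : ∀ A, (H A : Set X) = ⋃ i, S.map i '' A := fun A => rfl
  have hc : ContractingWith K H := by
    refine ⟨hK, fun A B => ?_⟩
    change Metric.hausdorffEDist (H A : Set X) (H B) ≤ K * Metric.hausdorffEDist (A : Set X) B
    rw [hH, hH]
    refine Metric.hausdorffEDist_iUnion_le.trans (iSup_le fun i => ?_)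
    have key : ∀ A B : TopologicalSpace.NonemptyCompacts X, ∀ x ∈ S.map i '' (A : Set X),
        Metric.infEDist x (S.map i '' (B : Set X)) ≤
          K * Metric.hausdorffEDist (A : Set X) B := by
      rintro A B _ ⟨a, ha, rfl⟩
      obtain ⟨b, hb, hab⟩ := B.isCompact.exists_infEDist_eq_edist B.nonempty a
      calc Metric.infEDist (S.map i a) (S.map i '' (B : Set X))
          ≤ edist (S.map i a) (S.map i b) :=
            Metric.infEDist_le_edist_of_mem (Set.mem_image_of_mem _ hb)
        _ ≤ K * edist a b := hL i a b
        _ ≤ K * Metric.hausdorffEDist (A : Set X) B := by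
            rw [← hab]
            gcongr
            exact Metric.infEDist_le_hausdorffEDist_of_mem ha
    refine Metric.hausdorffEDist_le_of_infEDist (key A B) fun x hx => ?_
    rw [Metric.hausdorffEDist_comm]
    exact key B A x hx
  let P : TopologicalSpace.NonemptyCompacts X := ContractingWith.fixedPoint H hc
  have hP : H P = P := hc.fixedPoint_isFixedPt
  refine ⟨(P : Set X), ⟨P.nonempty, P.isCompact, ?_⟩, ?_⟩
  · rw [← hH, hP]
  · rintro E ⟨hne, hcpt, hE⟩
    have hfix : Function.IsFixedPt H ⟨⟨E, hcpt⟩, hne⟩ := TopologicalSpace.NonemptyCompacts.ext hE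
    exact congrArg (fun A : TopologicalSpace.NonemptyCompacts X => (A : Set X))
      (hc.fixedPoint_unique hfix)

/-- The attractor: the unique nonempty compact set `E` with `⋃ i, S i (E) = E`. -/
noncomputable def attractor [Fintype ι] [Nonempty ι] [CompleteSpace X] [Nonempty X]
    (S : SimilitudeIFS ι X) : Set X :=
  S.existsUnique_isAttractor.choose

theorem isAttractor_attractor [Fintype ι] [Nonempty ι] [CompleteSpace X] [Nonempty X]
    (S : SimilitudeIFS ι X) : S.IsAttractor S.attractor :=
  S.existsUnique_isAttractor.choose_spec.1

end SimilitudeIFS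

/-- A contraction vector in `ℝ`. -/
structure IsContractionVector {n : ℕ} (ρ : Fin n → ℝ) : Prop where
  pos : ∀ i, 0 < ρ i
  lt_one : ∀ i, ρ i < 1
  sum_lt_one : ∑ i, ρ i < 1

/-- The family `x ↦ ρ i * x + t i` of similitudes of `ℝ`. -/
def affineIFS {n : ℕ} (ρ : Fin n → ℝ) (hρ : IsContractionVector ρ) (t : Fin n → ℝ) :
    SimilitudeIFS (Fin n) ℝ where
  map i x := ρ i * x + t i
  ratio := ρ
  ratio_pos := hρ.pos
  ratio_lt_one := hρ.lt_one
  dist_map i x y := by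
    rw [Real.dist_eq, Real.dist_eq, add_sub_add_right_eq_sub, ← mul_sub, abs_mul,
      abs_of_pos (hρ.pos i)]

/-- The set `M_ρ`: the attractor of `ρ₁ x`, `ρ₂ x + d₂`, `ρ₃ x + (1 - ρ₃)`. -/
noncomputable def separatedSet (ρ : Fin 3 → ℝ) (hρ : IsContractionVector ρ) (d₂ : ℝ) : Set ℝ :=
  (affineIFS ρ hρ ![0, d₂, 1 - ρ 2]).attractor

/-- The set `M'_ρ`: the attractor of `ρ₁ x`, `ρ₂ x + (1 - ρ₂ - ρ₃)`, `ρ₃ x + (1 - ρ₃)`. -/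
noncomputable def touchingSet (ρ : Fin 3 → ℝ) (hρ : IsContractionVector ρ) : Set ℝ :=
  (affineIFS ρ hρ ![0, 1 - ρ 1 - ρ 2, 1 - ρ 2]).attractor

/-! Write a, b, c for the three ratios. Both sets contain 0 and 1, and in both the first piece is
followed by a gap; they differ only at the point where the second and third pieces of the touching
set meet.

If log a / log c is rational, then a^p = c^q for some p ≥ 2, and both sets are cut simultaneously
into matching, uniformly separated pieces; `lipschitzEquivalent_of_refinement` turns such a scheme
into a bi-Lipschitz map. Cuts are made only in gaps behind first subcopies, which both sets have.
What cannot be cut in the touching set is a neighbourhood of a touching point. It is kept as a pair: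
what remains of a copy ending there, of size r b c^n, and a copy starting there, of size r c a^m. In
the separated set the two members are merely far apart on the scale r. Peeling pieces off the left
member raises n, and peeling off the right member raises m. Doing this forever would leave the
members too far apart in the separated set for their sizes. At n = q + 1 and m = p - 1, however, a^p
= c^q gives the left member the size of a subcopy of the right member. Exchanging the two on the
separated side brings the members close together again, and the pair restarts on the scale r a^p
with n = 1, m = 0 (`refines_swap`). Hence n and m stay bounded and all constants are uniform.

Conversely, let f be bi-Lipschitz and let s satisfy a^s + b^s + c^s = 1. The separated set carries a
subadditive content μ, bounded by 1, that scales exactly with the weights u = ρ^s. Pulled back by f,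
it gives each cylinder of the touching set at most a constant times its weight. Near a cylinder v
where the quotient of content by weight is almost maximal, the content of every fixed subpattern is
almost proportional to its weight (`exists_almost_proportional`). Take inside v two isolated pieces
on either side of the touching point, at a comparable distance from it: the left one in a copy of
relative size b c^k, the right one in a copy of relative size c a^m, where a^m is about c^k. Their
preimages lie in one cylinder of the separated set of comparable size, and are unions of its
subcylinders of a level D independent of v, k and m. So the quotient of their contents takes
finitely many values, and in the limit so does the quotient of their weights
(`exists_finite_ratios`). Two different k with the same quotient give a multiplicative relation
between a and c. -/

/-- Any point of `A` is at distance at least `δ` from any point of `B`. -/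
def SeparatedBy {X : Type*} [MetricSpace X] (δ : ℝ) (A B : Set X) : Prop :=
  ∀ a ∈ A, ∀ b ∈ B, δ ≤ dist a b

namespace SeparatedBy

variable {X : Type*} [MetricSpace X] {δ δ' : ℝ} {A A' B B' : Set X}

theorem symm (h : SeparatedBy δ A B) : SeparatedBy δ B A := fun b hb a ha => by
  rw [dist_comm]; exact h a ha b hb

theorem mono (h : SeparatedBy δ A B) (hδ : δ' ≤ δ) (hA : A' ⊆ A) (hB : B' ⊆ B) :
    SeparatedBy δ' A' B' := fun a ha b hb => hδ.trans (h a (hA ha) b (hB hb))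

theorem union_left (h : SeparatedBy δ A B) (h' : SeparatedBy δ A' B) :
    SeparatedBy δ (A ∪ A') B := by
  rintro a (ha | ha) b hb
  exacts [h a ha b hb, h' a ha b hb]

theorem union_right (h : SeparatedBy δ A B) (h' : SeparatedBy δ A B') :
    SeparatedBy δ A (B ∪ B') := (h.symm.union_left h'.symm).symm

end SeparatedBy

/-! ### Bi-Lipschitz maps from parallel refinements -/

section Matching

variable {X : Type*} [MetricSpace X]

/-- The points `x` and `y` lie in corresponding members of the `n`-th refinement of `S`. -/
def RefinementRel (ch : Set X × Set X × ℝ → List (Set X × Set X × ℝ)) :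
    ℕ → Set X × Set X × ℝ → X → X → Prop
  | 0, S, x, y => x ∈ S.1 ∧ y ∈ S.2.1
  | n + 1, S, x, y => ∃ S' ∈ ch S, RefinementRel ch n S' x y

/-- Both sets of `S` split into the same finite number of pieces, separated on the scale of `S`,
and corresponding pieces form triples satisfying `G` on a scale smaller by a factor `θ`. -/
def Refines (G : Set X × Set X × ℝ → Prop) (θ c : ℝ) (S : Set X × Set X × ℝ) : Prop :=
  ∃ l : List (Set X × Set X × ℝ),
    (∀ S' ∈ l, G S' ∧ S'.2.2 ≤ θ * S.2.2) ∧
    l.Pairwise (fun T T' => SeparatedBy (c * S.2.2) T.1 T'.1 ∧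
      SeparatedBy (c * S.2.2) T.2.1 T'.2.1) ∧
    (∀ x, x ∈ S.1 ↔ ∃ S' ∈ l, x ∈ S'.1) ∧ ∀ x, x ∈ S.2.1 ↔ ∃ S' ∈ l, x ∈ S'.2.1

/-- Two compact sets that can be refined indefinitely, in parallel, into finitely many uniformly
separated pieces are Lipschitz equivalent. -/
theorem lipschitzEquivalent_of_refinement (G : Set X × Set X × ℝ → Prop) (θ c C : ℝ)
    (hθ0 : 0 ≤ θ) (hθ : θ < 1) (hc : 0 < c) (hC : 0 < C)
    (hcpt : ∀ S, G S → IsCompact S.1 ∧ IsCompact S.2.1)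
    (hne : ∀ S, G S → S.1.Nonempty ∧ S.2.1.Nonempty)
    (hdiam : ∀ S, G S → (∀ x ∈ S.1, ∀ x' ∈ S.1, dist x x' ≤ C * S.2.2) ∧
      ∀ x ∈ S.2.1, ∀ x' ∈ S.2.1, dist x x' ≤ C * S.2.2)
    (hsplit : ∀ S, G S → Refines G θ c S)
    {A B : Set X} {σ : ℝ} (hAB : G (A, B, σ)) : LipschitzEquivalent A B := by
  classical
  unfold Refines at hsplit
  choose! ch hch hsep hA hB using hsplit
  let R := RefinementRel ch
  have R0 : ∀ n S x y, G S → R n S x y → x ∈ S.1 ∧ y ∈ S.2.1 := by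
    intro n
    induction n with
    | zero => intro S x y _ h; exact h
    | succ n ih =>
      rintro S x y hS ⟨S', hS', h⟩
      have := ih S' x y (hch S hS S' hS').1 h
      exact ⟨(hA S hS x).2 ⟨S', hS', this.1⟩, (hB S hS y).2 ⟨S', hS', this.2⟩⟩
  have Rmono : ∀ n S x y, G S → R (n + 1) S x y → R n S x y := by
    intro n
    induction n with
    | zero => intro S x y hS h; exact R0 1 S x y hS h
    | succ n ih =>
      rintro S x y hS ⟨S', hS', h⟩
      exact ⟨S', hS', ih S' x y (hch S hS S' hS').1 h⟩
  have Rne : ∀ n S x, G S → x ∈ S.1 → ∃ y, R n S x y := by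
    intro n
    induction n with
    | zero => intro S x hS hx; obtain ⟨y, hy⟩ := (hne S hS).2; exact ⟨y, hx, hy⟩
    | succ n ih =>
      intro S x hS hx
      obtain ⟨S', hS', hx'⟩ := (hA S hS x).1 hx
      obtain ⟨y, hy⟩ := ih S' x (hch S hS S' hS').1 hx'
      exact ⟨y, S', hS', hy⟩
  have Rne' : ∀ n S y, G S → y ∈ S.2.1 → ∃ x, R n S x y := by
    intro n
    induction n with
    | zero => intro S x hS hx; obtain ⟨y, hy⟩ := (hne S hS).1; exact ⟨y, hy, hx⟩
    | succ n ih =>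
      intro S x hS hx
      obtain ⟨S', hS', hx'⟩ := (hB S hS x).1 hx
      obtain ⟨y, hy⟩ := ih S' x (hch S hS S' hS').1 hx'
      exact ⟨y, S', hS', hy⟩
  have Rcl : ∀ n S x, G S → IsClosed {y | R n S x y} := by
    intro n
    induction n with
    | zero =>
      intro S x hS
      by_cases hx : x ∈ S.1
      · have : {y | R 0 S x y} = S.2.1 := by
          ext y; exact ⟨fun h => h.2, fun h => ⟨hx, h⟩⟩
        rw [this]; exact (hcpt S hS).2.isClosed
      · have : {y | R 0 S x y} = ∅ := by
          ext y; exact ⟨fun h => hx h.1, fun h => h.elim⟩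
        rw [this]; exact isClosed_empty
    | succ n ih =>
      intro S x hS
      have : {y | R (n + 1) S x y} = ⋃ S' ∈ {T | T ∈ ch S}, {y | R n S' x y} := by
        ext y
        simp only [Set.mem_iUnion, Set.mem_ofPred_eq, exists_prop]
        rfl
      rw [this]
      exact (List.finite_toSet _).isClosed_biUnion fun S' hS' => ih S' x (hch S hS S' hS').1
  have Rcl' : ∀ n S y, G S → IsClosed {x | R n S x y} := by
    intro n
    induction n with
    | zero =>
      intro S x hS
      by_cases hx : x ∈ S.2.1
      · have : {y | R 0 S y x} = S.1 := by
          ext y; exact ⟨fun h => h.1, fun h => ⟨h, hx⟩⟩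
        rw [this]; exact (hcpt S hS).1.isClosed
      · have : {y | R 0 S y x} = ∅ := by
          ext y; exact ⟨fun h => hx h.2, fun h => h.elim⟩
        rw [this]; exact isClosed_empty
    | succ n ih =>
      intro S x hS
      have : {y | R (n + 1) S y x} = ⋃ S' ∈ {T | T ∈ ch S}, {y | R n S' y x} := by
        ext y
        simp only [Set.mem_iUnion, Set.mem_ofPred_eq, exists_prop]
        rfl
      rw [this]
      exact (List.finite_toSet _).isClosed_biUnion fun S' hS' => ih S' x (hch S hS S' hS').1
  -- Follow the two pairs until they enter different pieces. There both distances lie between c and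
  -- C times the current scale, hence are comparable. If this has not happened after n steps, both
  -- distances are at most C θ^n σ.
  have Rlip : ∀ n S x y x' y', G S → R n S x y → R n S x' y' →
      (dist y y' ≤ C / c * dist x x' ∨ dist y y' ≤ C * (θ ^ n * S.2.2)) ∧
      (dist x x' ≤ C / c * dist y y' ∨ dist x x' ≤ C * (θ ^ n * S.2.2)) := by
    intro n
    induction n with
    | zero =>
      intro S x y x' y' hS h h'
      rw [pow_zero, one_mul]
      exact ⟨Or.inr ((hdiam S hS).2 _ h.2 _ h'.2), Or.inr ((hdiam S hS).1 _ h.1 _ h'.1)⟩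
    | succ n ih =>
      rintro S x y x' y' hS ⟨S₁, hS₁, h₁⟩ ⟨S₂, hS₂, h₂⟩
      by_cases heq : S₁ = S₂
      · subst heq
        have hle : C * (θ ^ n * S₁.2.2) ≤ C * (θ ^ (n + 1) * S.2.2) := by
          rw [pow_succ, mul_assoc (θ ^ n)]
          have := (hch S hS S₁ hS₁).2
          gcongr
        obtain ⟨i₁, i₂⟩ := ih S₁ x y x' y' (hch S hS S₁ hS₁).1 h₁ h₂
        exact ⟨i₁.imp_right fun h => h.trans hle, i₂.imp_right fun h => h.trans hle⟩
      · have hs : SeparatedBy (c * S.2.2) S₁.1 S₂.1 ∧ SeparatedBy (c * S.2.2) S₁.2.1 S₂.2.1 :=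
          haveI : Std.Symm (fun T T' : Set X × Set X × ℝ => SeparatedBy (c * S.2.2) T.1 T'.1 ∧
            SeparatedBy (c * S.2.2) T.2.1 T'.2.1) := ⟨fun _ _ h => ⟨h.1.symm, h.2.symm⟩⟩
          (hsep S hS).forall hS₁ hS₂ heq
        have m₁ := R0 n S₁ x y (hch S hS S₁ hS₁).1 h₁
        have m₂ := R0 n S₂ x' y' (hch S hS S₂ hS₂).1 h₂
        have d₁ := hs.1 x m₁.1 x' m₂.1
        have d₂ := hs.2 y m₁.2 y' m₂.2
        have e₁ := (hdiam S hS).1 x ((hA S hS x).2 ⟨S₁, hS₁, m₁.1⟩) x'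
          ((hA S hS x').2 ⟨S₂, hS₂, m₂.1⟩)
        have e₂ := (hdiam S hS).2 y ((hB S hS y).2 ⟨S₁, hS₁, m₁.2⟩) y'
          ((hB S hS y').2 ⟨S₂, hS₂, m₂.2⟩)
        have key : ∀ t, c * S.2.2 ≤ t → C * S.2.2 ≤ C / c * t := fun t ht => by
          rw [div_mul_eq_mul_div, le_div_iff₀ hc, mul_assoc, mul_comm S.2.2]
          gcongr
        exact ⟨Or.inl (e₂.trans (key _ d₁)), Or.inl (e₁.trans (key _ d₂))⟩
  have hlim : Filter.Tendsto (fun n : ℕ => C * (θ ^ n * σ)) Filter.atTop (nhds 0) := by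
    simpa using ((tendsto_pow_atTop_nhds_zero_of_lt_one hθ0 hθ).mul_const σ).const_mul C
  have lim : ∀ u v : ℝ, 0 ≤ v → (∀ n : ℕ, u ≤ v ∨ u ≤ C * (θ ^ n * σ)) → u ≤ v := by
    intro u v hv h
    by_contra huv
    have : u ≤ 0 := ge_of_tendsto' hlim fun n => (h n).resolve_left huv
    exact huv (this.trans hv)
  have hCc : 0 < C / c := div_pos hC hc
  let S : Set X × Set X × ℝ := (A, B, σ)
  have lip₁ : ∀ x y x' y', (∀ n, R n S x y) → (∀ n, R n S x' y') →
      dist y y' ≤ C / c * dist x x' := fun x y x' y' h h' =>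
    lim _ _ (by positivity) fun n => (Rlip n S x y x' y' hAB (h n) (h' n)).1
  have lip₂ : ∀ x y x' y', (∀ n, R n S x y) → (∀ n, R n S x' y') →
      dist x x' ≤ C / c * dist y y' := fun x y x' y' h h' =>
    lim _ _ (by positivity) fun n => (Rlip n S x y x' y' hAB (h n) (h' n)).2
  -- The partners of x up to level n form decreasing nonempty compact sets, so some y is a partner
  -- at all levels.
  have ex₁ : ∀ x ∈ A, ∃ y, ∀ n, R n S x y := by
    intro x hx
    have := IsCompact.nonempty_iInter_of_sequence_nonempty_isCompact_isClosed
      (fun n => {y | R n S x y}) (fun n y h => Rmono n S x y hAB h)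
      (fun n => Rne n S x hAB hx)
      ((hcpt S hAB).2.of_isClosed_subset (Rcl 0 S x hAB) fun y h => h.2)
      (fun n => Rcl n S x hAB)
    obtain ⟨y, hy⟩ := this
    exact ⟨y, fun n => Set.mem_iInter.1 hy n⟩
  have ex₂ : ∀ y ∈ B, ∃ x, ∀ n, R n S x y := by
    intro y hy
    have := IsCompact.nonempty_iInter_of_sequence_nonempty_isCompact_isClosed
      (fun n => {x | R n S x y}) (fun n x h => Rmono n S x y hAB h)
      (fun n => Rne' n S y hAB hy)
      ((hcpt S hAB).1.of_isClosed_subset (Rcl' 0 S y hAB) fun y h => h.1)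
      (fun n => Rcl' n S y hAB)
    obtain ⟨x, hx⟩ := this
    exact ⟨x, fun n => Set.mem_iInter.1 hx n⟩
  choose f hf using fun x : A => ex₁ x x.2
  choose g hg using fun y : B => ex₂ y y.2
  have uniq₁ : ∀ x y y', (∀ n, R n S x y) → (∀ n, R n S x y') → y = y' := fun x y y' h h' =>
    dist_le_zero.1 (by simpa using lip₁ x y x y' h h')
  have uniq₂ : ∀ x x' y, (∀ n, R n S x y) → (∀ n, R n S x' y) → x = x' := fun x x' y h h' =>
    dist_le_zero.1 (by simpa using lip₂ x y x' y h h')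
  let e : A ≃ B :=
    { toFun := fun x => ⟨f x, (hf x 0).2⟩
      invFun := fun y => ⟨g y, (hg y 0).1⟩
      left_inv := fun x => Subtype.ext (uniq₂ _ _ _ (hg ⟨f x, (hf x 0).2⟩) (hf x))
      right_inv := fun y => Subtype.ext (uniq₁ _ _ _ (hf ⟨g y, (hg y 0).1⟩) (hg y)) }
  refine ⟨e, (C / c)⁻¹, inv_pos.2 hCc, C / c, hCc, fun x y => ⟨?_, lip₁ _ _ _ _ (hf x) (hf y)⟩⟩
  rw [inv_mul_le_iff₀ hCc]
  exact lip₂ _ _ _ _ (hf x) (hf y)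

end Matching

/-! ### Ternary sets: copies, upper parts and their gaps -/

/-- `E` is a compact subset of `[0, 1]` containing `0` and `1` that is the union of its images under
`x ↦ a * x`, `x ↦ b * x + d` and `x ↦ c * x + (1 - c)`, the first image lying strictly to the left
of the other two. -/
structure IsTernarySet (a b c d : ℝ) (E : Set ℝ) : Prop where
  a_pos : 0 < a
  b_pos : 0 < b
  c_pos : 0 < c
  a_lt : a < d
  d_le : d ≤ 1 - b - c
  isCompact : IsCompact E
  zero_mem : 0 ∈ E
  one_mem : 1 ∈ E
  subset_Icc : E ⊆ Set.Icc 0 1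
  mem_iff : ∀ x, x ∈ E ↔
    (∃ y ∈ E, x = a * y) ∨ (∃ y ∈ E, x = b * y + d) ∨ ∃ y ∈ E, x = c * y + (1 - c)

/-- The image of `E` under `y ↦ t + s * y`. -/
def scaledCopy (E : Set ℝ) (t s : ℝ) : Set ℝ := (fun y => t + s * y) '' E

/-- The part of `scaledCopy E t s` formed by its second and third subcopies. -/
def upperPart (b c d : ℝ) (E : Set ℝ) (t s : ℝ) : Set ℝ :=
  scaledCopy E (t + s * d) (s * b) ∪ scaledCopy E (t + s * (1 - c)) (s * c)

theorem scaledCopy_subset_Icc {E : Set ℝ} (hE : E ⊆ Set.Icc 0 1) {t s : ℝ} (hs : 0 ≤ s) :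
    scaledCopy E t s ⊆ Set.Icc t (t + s) := by
  rintro _ ⟨y, hy, rfl⟩
  have := hE hy
  simp only [Set.mem_Icc] at this ⊢
  constructor <;> nlinarith

theorem separatedBy_of_le {A B : Set ℝ} {δ r l : ℝ} (hA : ∀ x ∈ A, x ≤ r) (hB : ∀ x ∈ B, l ≤ x)
    (h : r + δ ≤ l) : SeparatedBy δ A B := fun x hx y hy => by
  rw [dist_comm, Real.dist_eq]
  have := hA x hx
  have := hB y hy
  exact le_trans (by linarith) (le_abs_self _)

namespace IsTernarySet

variable {a b c d : ℝ} {E : Set ℝ}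

theorem scaledCopy_eq (h : IsTernarySet a b c d E) (t s : ℝ) :
    scaledCopy E t s = scaledCopy E t (s * a) ∪ upperPart b c d E t s := by
  ext x
  simp only [scaledCopy, upperPart, Set.mem_union, Set.mem_image]
  constructor
  · rintro ⟨y, hy, rfl⟩
    rcases (h.mem_iff y).1 hy with ⟨z, hz, rfl⟩ | ⟨z, hz, rfl⟩ | ⟨z, hz, rfl⟩
    · exact Or.inl ⟨z, hz, by ring⟩
    · exact Or.inr (Or.inl ⟨z, hz, by ring⟩)
    · exact Or.inr (Or.inr ⟨z, hz, by ring⟩)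
  · rintro (⟨z, hz, rfl⟩ | ⟨z, hz, rfl⟩ | ⟨z, hz, rfl⟩)
    · exact ⟨_, (h.mem_iff _).2 (Or.inl ⟨z, hz, rfl⟩), by ring⟩
    · exact ⟨_, (h.mem_iff _).2 (Or.inr (Or.inl ⟨z, hz, rfl⟩)), by ring⟩
    · exact ⟨_, (h.mem_iff _).2 (Or.inr (Or.inr ⟨z, hz, rfl⟩)), by ring⟩

theorem upperPart_subset (h : IsTernarySet a b c d E) (t s : ℝ) :
    upperPart b c d E t s ⊆ scaledCopy E t s := by
  rw [h.scaledCopy_eq t s]; exact Set.subset_union_right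

theorem isCompact_scaledCopy (h : IsTernarySet a b c d E) (t s : ℝ) :
    IsCompact (scaledCopy E t s) :=
  h.isCompact.image (by fun_prop)

theorem isCompact_upperPart (h : IsTernarySet a b c d E) (t s : ℝ) :
    IsCompact (upperPart b c d E t s) :=
  (h.isCompact_scaledCopy _ _).union (h.isCompact_scaledCopy _ _)

theorem scaledCopy_nonempty (h : IsTernarySet a b c d E) (t s : ℝ) :
    (scaledCopy E t s).Nonempty := ⟨_, 0, h.zero_mem, rfl⟩

theorem d_lt_one (h : IsTernarySet a b c d E) : d < 1 := by
  linarith [h.d_le, h.b_pos, h.c_pos]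

theorem b_lt_one (h : IsTernarySet a b c d E) : b < 1 := by
  linarith [h.d_le, h.a_pos, h.c_pos, h.a_lt]

theorem c_lt_one (h : IsTernarySet a b c d E) : c < 1 := by
  linarith [h.d_le, h.a_pos, h.b_pos, h.a_lt]

theorem a_lt_one (h : IsTernarySet a b c d E) : a < 1 := by
  linarith [h.d_lt_one, h.a_lt]

theorem scaledCopy_bounds (h : IsTernarySet a b c d E) {t s x : ℝ} (hs : 0 ≤ s)
    (hx : x ∈ scaledCopy E t s) : t ≤ x ∧ x ≤ t + s :=
  scaledCopy_subset_Icc h.subset_Icc hs hx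

theorem upperPart_bounds (h : IsTernarySet a b c d E) {t s x : ℝ} (hs : 0 ≤ s)
    (hx : x ∈ upperPart b c d E t s) : t + s * d ≤ x ∧ x ≤ t + s := by
  have hb := mul_nonneg hs h.b_pos.le
  have hc := mul_nonneg hs h.c_pos.le
  have hd := mul_le_mul_of_nonneg_left h.d_le hs
  rcases hx with hx | hx
  · have := h.scaledCopy_bounds hb hx
    constructor <;> linarith
  · have := h.scaledCopy_bounds hc hx
    constructor <;> linarith

/-- A lower bound for the relative size of all gaps that are used. -/
def gapBound (a b c d : ℝ) : ℝ := b * c * (d - a)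

theorem gapBound_pos (h : IsTernarySet a b c d E) : 0 < gapBound a b c d :=
  mul_pos (mul_pos h.b_pos h.c_pos) (sub_pos.2 h.a_lt)

theorem gapBound_le (h : IsTernarySet a b c d E) :
    gapBound a b c d ≤ b * (d - a) ∧ gapBound a b c d ≤ c * (d - a) ∧
      gapBound a b c d ≤ d - a := by
  have hda := sub_pos.2 h.a_lt
  have h₁ : gapBound a b c d ≤ b * (d - a) := by
    have := mul_le_of_le_one_right h.b_pos.le h.c_lt_one.le
    exact mul_le_mul_of_nonneg_right this hda.le
  have h₂ : gapBound a b c d ≤ c * (d - a) := by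
    have := mul_le_of_le_one_left h.c_pos.le h.b_lt_one.le
    exact mul_le_mul_of_nonneg_right this hda.le
  exact ⟨h₁, h₂, h₁.trans (mul_le_of_le_one_left hda.le h.b_lt_one.le)⟩

section Gaps

variable (h : IsTernarySet a b c d E) {t s : ℝ} (hs : 0 ≤ s)
include h hs

theorem sep_first_upper :
    SeparatedBy (s * gapBound a b c d) (scaledCopy E t (s * a)) (upperPart b c d E t s) := by
  have hg := mul_le_mul_of_nonneg_left h.gapBound_le.2.2 hs
  exact separatedBy_of_le (fun x hx => (h.scaledCopy_bounds (mul_nonneg hs h.a_pos.le) hx).2)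
    (fun x hx => (h.upperPart_bounds hs hx).1) (by linarith)

theorem sep_Iic_upper : SeparatedBy (s * gapBound a b c d) (Set.Iic t) (upperPart b c d E t s) := by
  have hg := mul_le_mul_of_nonneg_left h.gapBound_le.2.2 hs
  have := mul_nonneg hs h.a_pos.le
  exact separatedBy_of_le (r := t) (fun x hx => hx)
    (fun x hx => (h.upperPart_bounds hs hx).1) (by linarith)

theorem bounds_21 {x : ℝ} (hx : x ∈ scaledCopy E (t + s * d) (s * b * a)) :
    x ≤ t + s * d + s * b * a :=
  (h.scaledCopy_bounds (mul_nonneg (mul_nonneg hs h.b_pos.le) h.a_pos.le) hx).2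

theorem sep_21_tail :
    SeparatedBy (s * gapBound a b c d) (scaledCopy E (t + s * d) (s * b * a))
      (upperPart b c d E (t + s * d) (s * b) ∪ scaledCopy E (t + s * (1 - c)) (s * c)) := by
  have hsb := mul_nonneg hs h.b_pos.le
  have hsc := mul_nonneg hs h.c_pos.le
  have hd := mul_le_mul_of_nonneg_left h.d_le hs
  have hbd := mul_le_mul_of_nonneg_left h.d_lt_one.le hsb
  have hg := mul_le_mul_of_nonneg_left h.gapBound_le.1 hs
  refine separatedBy_of_le (fun x hx => h.bounds_21 hs hx) (l := t + s * d + s * b * d) ?_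
    (by linarith)
  rintro x (hx | hx)
  · exact (h.upperPart_bounds hsb hx).1
  · have := (h.scaledCopy_bounds hsc hx).1
    linarith

theorem sep_21_Ici :
    SeparatedBy (s * gapBound a b c d) (scaledCopy E (t + s * d) (s * b * a))
      (Set.Ici (t + s)) := by
  have hsb := mul_nonneg hs h.b_pos.le
  have hsc := mul_nonneg hs h.c_pos.le
  have hd := mul_le_mul_of_nonneg_left h.d_le hs
  have hbd := mul_le_mul_of_nonneg_left h.d_lt_one.le hsb
  have hg := mul_le_mul_of_nonneg_left h.gapBound_le.1 hs
  exact separatedBy_of_le (fun x hx => h.bounds_21 hs hx) (l := t + s) (fun x hx => hx)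
    (by linarith)

theorem bounds_middle {x : ℝ} (hx : x ∈ upperPart b c d E (t + s * d) (s * b) ∪
    scaledCopy E (t + s * (1 - c)) (s * c * a)) : x ≤ t + s * (1 - c) + s * c * a := by
  have hsb := mul_nonneg hs h.b_pos.le
  have hsca := mul_nonneg (mul_nonneg hs h.c_pos.le) h.a_pos.le
  have hd := mul_le_mul_of_nonneg_left h.d_le hs
  rcases hx with hx | hx
  · have := (h.upperPart_bounds hsb hx).2
    linarith
  · exact (h.scaledCopy_bounds hsca hx).2

theorem sep_middle_last :
    SeparatedBy (s * gapBound a b c d)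
      (upperPart b c d E (t + s * d) (s * b) ∪ scaledCopy E (t + s * (1 - c)) (s * c * a))
      (upperPart b c d E (t + s * (1 - c)) (s * c)) := by
  have hsc := mul_nonneg hs h.c_pos.le
  have hg := mul_le_mul_of_nonneg_left h.gapBound_le.2.1 hs
  exact separatedBy_of_le (fun x hx => h.bounds_middle hs hx)
    (fun x hx => (h.upperPart_bounds hsc hx).1) (by linarith)

theorem sep_middle_Ici :
    SeparatedBy (s * gapBound a b c d)
      (upperPart b c d E (t + s * d) (s * b) ∪ scaledCopy E (t + s * (1 - c)) (s * c * a))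
      (Set.Ici (t + s)) := by
  have hsc := mul_nonneg hs h.c_pos.le
  have hg := mul_le_mul_of_nonneg_left h.gapBound_le.2.1 hs
  have hd := mul_le_mul_of_nonneg_left h.d_lt_one.le hsc
  exact separatedBy_of_le (fun x hx => h.bounds_middle hs hx) (l := t + s) (fun x hx => hx)
    (by linarith)

theorem sep_second_third :
    SeparatedBy (s * (1 - c - d - b)) (scaledCopy E (t + s * d) (s * b))
      (scaledCopy E (t + s * (1 - c)) (s * c)) := by
  have hsc := mul_nonneg hs h.c_pos.le
  have hsb := mul_nonneg hs h.b_pos.le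
  exact separatedBy_of_le (fun x hx => (h.scaledCopy_bounds hsb hx).2)
    (fun x hx => (h.scaledCopy_bounds hsc hx).1) (by linarith)

end Gaps

/-- The upper part of a copy, split at the first gaps of its two subcopies. -/
theorem upperPart_eq_three (h : IsTernarySet a b c d E) (t s : ℝ) :
    upperPart b c d E t s = scaledCopy E (t + s * d) (s * b * a) ∪
      (upperPart b c d E (t + s * d) (s * b) ∪ scaledCopy E (t + s * (1 - c)) (s * c * a)) ∪
        upperPart b c d E (t + s * (1 - c)) (s * c) := by
  rw [upperPart, h.scaledCopy_eq (t + s * d), h.scaledCopy_eq (t + s * (1 - c))]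
  simp only [Set.union_assoc]

theorem upperPart_eq_two (h : IsTernarySet a b c d E) (t s : ℝ) :
    upperPart b c d E t s = scaledCopy E (t + s * d) (s * b * a) ∪
      (upperPart b c d E (t + s * d) (s * b) ∪ scaledCopy E (t + s * (1 - c)) (s * c)) := by
  rw [upperPart, h.scaledCopy_eq (t + s * d)]
  simp only [Set.union_assoc]

theorem scaledCopy_first_subset (h : IsTernarySet a b c d E) (t s : ℝ) :
    scaledCopy E t (s * a) ⊆ scaledCopy E t s := by
  rw [h.scaledCopy_eq t s]; exact Set.subset_union_left

theorem scaledCopy_second_subset (h : IsTernarySet a b c d E) (t s : ℝ) :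
    scaledCopy E (t + s * d) (s * b) ⊆ scaledCopy E t s := by
  rw [h.scaledCopy_eq t s]
  exact Set.subset_union_left.trans Set.subset_union_right

theorem scaledCopy_third_subset (h : IsTernarySet a b c d E) (t s : ℝ) :
    scaledCopy E (t + s * (1 - c)) (s * c) ⊆ scaledCopy E t s := by
  rw [h.scaledCopy_eq t s]
  exact Set.subset_union_right.trans Set.subset_union_right

theorem dist_le_of_mem_scaledCopy (h : IsTernarySet a b c d E) {t s x y : ℝ} (hs : 0 ≤ s)
    (hx : x ∈ scaledCopy E t s) (hy : y ∈ scaledCopy E t s) : dist x y ≤ s := by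
  have := Real.dist_le_of_mem_Icc (scaledCopy_subset_Icc h.subset_Icc hs hx)
    (scaledCopy_subset_Icc h.subset_Icc hs hy)
  linarith

/-- The bound s holds as well; s / a is the weaker form carried by all pairs, since a swapped pair
only satisfies the latter. -/
theorem dist_second_third_le (h : IsTernarySet a b c d E) {t s : ℝ} (hs : 0 ≤ s) :
    ∀ x ∈ scaledCopy E (t + s * d) (s * b), ∀ y ∈ scaledCopy E (t + s * (1 - c)) (s * c),
      dist x y ≤ s / a := fun _ hx _ hy =>
  (h.dist_le_of_mem_scaledCopy hs (h.scaledCopy_second_subset t s hx)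
    (h.scaledCopy_third_subset t s hy)).trans
      ((le_div_iff₀ h.a_pos).2 (mul_le_of_le_one_right hs h.a_lt_one.le))

end IsTernarySet

/-! ### States of the parallel refinement and how they split -/

/-- The pairs of sets occurring in the parallel refinement of `E` and `E'`, with their scales: copies
of `E` and `E'`, and unions of two neighbouring copies, touching each other on the side of `E'`, the
first one without its first subcopy. -/
inductive ParallelState (a b c d d' : ℝ) (E E' : Set ℝ) (p q : ℕ) (θ κ : ℝ) :
    Set ℝ × Set ℝ × ℝ → Prop
  | single (t t' s : ℝ) (hs : 0 < s) :
      ParallelState a b c d d' E E' p q θ κ (scaledCopy E t s, scaledCopy E' t' s, s)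
  | pair (r tx ty tx' ty' sx sy : ℝ) (n m : ℕ) (hr : 0 < r) (hn : n ≤ q + 1) (hm : m + 1 ≤ p)
      (hsx : sx = r * b * c ^ n) (hsy : sy = r * c * a ^ m)
      (hsep : SeparatedBy (r * κ) (scaledCopy E tx sx) (scaledCopy E ty sy))
      (hdist : ∀ x ∈ scaledCopy E tx sx, ∀ y ∈ scaledCopy E ty sy, dist x y ≤ r / a) (htouch : ty' = tx' + sx) :
      ParallelState a b c d d' E E' p q θ κ
        (upperPart b c d E tx sx ∪ scaledCopy E ty sy,
          upperPart b c d' E' tx' sx ∪ scaledCopy E' ty' sy, θ ^ (n + m + 1) * r)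

namespace ParallelState

variable {a b c d d' : ℝ} {E E' : Set ℝ} {p q : ℕ} {θ κ η : ℝ}

/-- The last two subcopies of a copy form a pair. -/
theorem pair_upper (h : IsTernarySet a b c d E) (hκ : κ ≤ 1 - c - d - b)
    (hd' : d' = 1 - b - c) (hp : 1 ≤ p)
    {t t' s : ℝ} (hs : 0 < s) :
    ParallelState a b c d d' E E' p q θ κ
      (upperPart b c d E (t + s * d) (s * b) ∪ scaledCopy E (t + s * (1 - c)) (s * c),
      upperPart b c d' E' (t' + s * d') (s * b) ∪ scaledCopy E' (t' + s * (1 - c)) (s * c),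
      θ * s) := by
  have ha := h.a_pos
  have hb := h.b_pos
  have := pair (a := a) (b := b) (c := c) (d := d) (d' := d') (E := E) (E' := E') (p := p)
    (q := q) (θ := θ) (κ := κ) s (t + s * d) (t + s * (1 - c))
    (t' + s * d') (t' + s * (1 - c)) (s * b) (s * c) 0 0 hs (by omega) (by omega) (by ring)
    (by ring) ((h.sep_second_third hs.le).mono (by gcongr) subset_rfl subset_rfl)
    (h.dist_second_third_le hs.le) (by rw [hd']; ring)
  simpa using this

/-- The second and third subcopies may touch, so the cuts are made behind the first subcopy and
behind the first subcopy of the second one. The rest is a pair. -/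
theorem refines_single (h : IsTernarySet a b c d E) (h' : IsTernarySet a b c d' E')
    (hd' : d' = 1 - b - c) (hp : 2 ≤ p)
    (haθ : a ≤ θ) (hbθ : b ≤ θ)
    (hκ : κ ≤ 1 - c - d - b) (hη : η ≤ IsTernarySet.gapBound a b c d)
    (hη' : η ≤ IsTernarySet.gapBound a b c d') (t t' s : ℝ) (hs : 0 < s) :
    Refines (ParallelState a b c d d' E E' p q θ κ) θ η
      (scaledCopy E t s, scaledCopy E' t' s, s) := by
  have ha := h.a_pos
  have hb := h.b_pos
  have hc := h.c_pos
  refine ⟨[(scaledCopy E t (s * a), scaledCopy E' t' (s * a), s * a),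
    (scaledCopy E (t + s * d) (s * b * a), scaledCopy E' (t' + s * d') (s * b * a), s * b * a),
    (upperPart b c d E (t + s * d) (s * b) ∪ scaledCopy E (t + s * (1 - c)) (s * c),
      upperPart b c d' E' (t' + s * d') (s * b) ∪ scaledCopy E' (t' + s * (1 - c)) (s * c),
      θ * s)], ?_, ?_, ?_, ?_⟩
  · simp only [List.mem_cons, List.not_mem_nil, or_false, forall_eq_or_imp, forall_eq]
    refine ⟨⟨single _ _ _ (by positivity), ?_⟩, ⟨single _ _ _ (by positivity), ?_⟩,
      pair_upper h hκ hd' (by omega) hs, le_rfl⟩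
    · rw [mul_comm]; gcongr
    · rw [mul_assoc, mul_comm]
      have : b * a ≤ b := mul_le_of_le_one_right hb.le h.a_lt_one.le
      exact mul_le_mul_of_nonneg_right (this.trans hbθ) hs.le
  · simp only [List.pairwise_cons, List.mem_cons, List.not_mem_nil, or_false, forall_eq_or_imp,
      forall_eq, List.Pairwise.nil, IsEmpty.forall_iff, implies_true, and_true]
    have hl : η * s ≤ s * IsTernarySet.gapBound a b c d := by rw [mul_comm]; gcongr
    have hl' : η * s ≤ s * IsTernarySet.gapBound a b c d' := by rw [mul_comm]; gcongr
    refine ⟨⟨⟨?_, ?_⟩, ?_, ?_⟩, ?_, ?_⟩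
    · refine (h.sep_first_upper hs.le).mono hl subset_rfl ?_
      rw [h.upperPart_eq_two t s]; exact Set.subset_union_left
    · refine (h'.sep_first_upper hs.le).mono hl' subset_rfl ?_
      rw [h'.upperPart_eq_two t' s]; exact Set.subset_union_left
    · refine (h.sep_first_upper hs.le).mono hl subset_rfl ?_
      rw [h.upperPart_eq_two t s]; exact Set.subset_union_right
    · refine (h'.sep_first_upper hs.le).mono hl' subset_rfl ?_
      rw [h'.upperPart_eq_two t' s]; exact Set.subset_union_right
    · exact (h.sep_21_tail hs.le).mono hl subset_rfl subset_rfl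
    · exact (h'.sep_21_tail hs.le).mono hl' subset_rfl subset_rfl
  · intro x
    simp only [List.mem_cons, List.not_mem_nil, or_false, exists_eq_or_imp, exists_eq_left]
    rw [h.scaledCopy_eq t s, h.upperPart_eq_two]
    simp only [Set.mem_union]
  · intro x
    simp only [List.mem_cons, List.not_mem_nil, or_false, exists_eq_or_imp, exists_eq_left]
    rw [h'.scaledCopy_eq t' s, h'.upperPart_eq_two]
    simp only [Set.mem_union]

/-- A piece whose size has gained one of the ratios a, b, c is below r θ^N. This outweighs all the
powers of θ that a pair spends on its indices n and m, so its scale drops by the required factor. -/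
theorem scale_le {u r : ℝ} {N j : ℕ} (hθ0 : 0 < θ) (hθ1 : θ ≤ 1) (hu0 : 0 ≤ u) (hr : 0 ≤ r)
    (hu : u ≤ r * θ ^ N) (k : ℕ) (hj : j + 1 ≤ N) : θ ^ k * u ≤ θ * (θ ^ j * r) := by
  have h₁ : θ ^ k * u ≤ u := mul_le_of_le_one_left hu0 (pow_le_one₀ hθ0.le hθ1)
  have h₂ : θ ^ N ≤ θ ^ (j + 1) := pow_le_pow_of_le_one hθ0.le hθ1 hj
  calc θ ^ k * u ≤ r * θ ^ (j + 1) := h₁.trans (hu.trans (by gcongr))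
    _ = θ * (θ ^ j * r) := by ring

section Pair

variable {r tx ty tx' ty' sx sy : ℝ} {n m N : ℕ}
  (h : IsTernarySet a b c d E) (h' : IsTernarySet a b c d' E')
  (hd' : d' = 1 - b - c) (hp : 2 ≤ p) (hθ0 : 0 < θ) (hθ1 : θ ≤ 1)
  (hN : p + q + 3 ≤ N)
  (hκ : κ ≤ 1 - c - d - b) (hr : 0 < r) (hm : m + 1 ≤ p)
  (hsx : sx = r * b * c ^ n) (hsy : sy = r * c * a ^ m)
  (hsx0 : 0 < sx) (hsy0 : 0 < sy) (hsxr : sx ≤ r * θ ^ N) (hsyr : sy ≤ r * θ ^ N)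
  (hsep : SeparatedBy (r * κ) (scaledCopy E tx sx) (scaledCopy E ty sy))
  (hdist : ∀ x ∈ scaledCopy E tx sx, ∀ y ∈ scaledCopy E ty sy, dist x y ≤ r / a) (htouch : ty' = tx' + sx)
  (hx : η * (θ ^ (n + m + 1) * r) ≤ sx * IsTernarySet.gapBound a b c d)
  (hx' : η * (θ ^ (n + m + 1) * r) ≤ sx * IsTernarySet.gapBound a b c d')
  (hy : η * (θ ^ (n + m + 1) * r) ≤ sy * IsTernarySet.gapBound a b c d)
  (hy' : η * (θ ^ (n + m + 1) * r) ≤ sy * IsTernarySet.gapBound a b c d')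
  (hxy : η * (θ ^ (n + m + 1) * r) ≤ r * κ)

-- Only the third subcopy of the left member reaches the touching point; it becomes the new left
-- member, with n + 1. The touching point between the second and third subcopies starts a new pair
-- on the scale `sx` with indices 0 and 1, which is where 2 ≤ p enters. The base r of the old pair
-- is unchanged; its scale decreases only through the additional factor θ.
include h h' hd' hp hθ0 hθ1 hN hκ hr hm hsx hsy hsx0 hsy0 hsxr hsep hdist htouch hx hx' hxy in
theorem refines_left (hn : n ≤ q) :
    Refines (ParallelState a b c d d' E E' p q θ κ) θ η
      (upperPart b c d E tx sx ∪ scaledCopy E ty sy,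
          upperPart b c d' E' tx' sx ∪ scaledCopy E' ty' sy, θ ^ (n + m + 1) * r) := by
  have ha := h.a_pos
  have hb := h.b_pos
  have hc := h.c_pos
  have hab : b * a ≤ 1 := mul_le_one₀ h.b_lt_one.le ha.le h.a_lt_one.le
  refine ⟨[(scaledCopy E (tx + sx * d) (sx * b * a), scaledCopy E' (tx' + sx * d') (sx * b * a),
      sx * b * a),
    (upperPart b c d E (tx + sx * d) (sx * b) ∪ scaledCopy E (tx + sx * (1 - c)) (sx * c * a),
      upperPart b c d' E' (tx' + sx * d') (sx * b) ∪
        scaledCopy E' (tx' + sx * (1 - c)) (sx * c * a), θ ^ (0 + 1 + 1) * sx),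
    (upperPart b c d E (tx + sx * (1 - c)) (sx * c) ∪ scaledCopy E ty sy,
      upperPart b c d' E' (tx' + sx * (1 - c)) (sx * c) ∪ scaledCopy E' ty' sy,
      θ ^ (n + 1 + m + 1) * r)], ?_, ?_, ?_, ?_⟩
  · simp only [List.mem_cons, List.not_mem_nil, or_false, forall_eq_or_imp, forall_eq]
    refine ⟨⟨single _ _ _ (by positivity), ?_⟩,
      ⟨pair sx _ _ _ _ _ _ 0 1 hsx0 (by omega) (by omega) (by ring) (by ring) ?_ ?_ ?_, ?_⟩,
      pair r _ _ _ _ _ _ (n + 1) m hr (by omega) (by omega) ?_ hsy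
        (hsep.mono le_rfl (h.scaledCopy_third_subset _ _) subset_rfl) ?_ ?_, ?_⟩
    · have : sx * b * a ≤ sx := by
        rw [mul_assoc]; exact mul_le_of_le_one_right hsx0.le hab
      simpa using scale_le hθ0 hθ1 (by positivity) hr.le (this.trans hsxr) 0
        (show n + m + 1 + 1 ≤ N by omega)
    · exact (h.sep_second_third hsx0.le).mono (by gcongr) subset_rfl
        (h.scaledCopy_first_subset _ _)
    · exact fun x hx y hy => h.dist_second_third_le hsx0.le x hx y
        (h.scaledCopy_first_subset _ _ hy)
    · rw [hd']; ring
    · exact scale_le hθ0 hθ1 hsx0.le hr.le hsxr _ (by omega)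
    · rw [hsx]; ring
    · exact fun x hx => hdist x (h.scaledCopy_third_subset _ _ hx)
    · rw [htouch]; ring
    · rw [← mul_assoc, ← pow_succ']
      exact le_of_eq (by ring)
  · simp only [List.pairwise_cons, List.mem_cons, List.not_mem_nil, or_false, forall_eq_or_imp,
      forall_eq, List.Pairwise.nil, IsEmpty.forall_iff, implies_true, and_true]
    have hIci : scaledCopy E' ty' sy ⊆ Set.Ici (tx' + sx) := fun x hx => by
      rw [← htouch]; exact (h'.scaledCopy_bounds hsy0.le hx).1
    refine ⟨⟨⟨?_, ?_⟩, ?_, ?_⟩, ?_, ?_⟩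
    · exact (h.sep_21_tail hsx0.le).mono hx subset_rfl
        (Set.union_subset_union subset_rfl (h.scaledCopy_first_subset _ _))
    · exact (h'.sep_21_tail hsx0.le).mono hx' subset_rfl
        (Set.union_subset_union subset_rfl (h'.scaledCopy_first_subset _ _))
    · exact ((h.sep_21_tail hsx0.le).mono hx subset_rfl ((h.upperPart_subset _ _).trans
        Set.subset_union_right)).union_right (hsep.mono hxy
          ((h.scaledCopy_first_subset _ _).trans (h.scaledCopy_second_subset _ _)) subset_rfl)
    · exact ((h'.sep_21_tail hsx0.le).mono hx' subset_rfl ((h'.upperPart_subset _ _).trans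
        Set.subset_union_right)).union_right ((h'.sep_21_Ici hsx0.le).mono hx' subset_rfl hIci)
    · refine ((h.sep_middle_last hsx0.le).mono hx subset_rfl subset_rfl).union_right
        (hsep.mono hxy (Set.union_subset ?_ ?_) subset_rfl)
      · exact (h.upperPart_subset _ _).trans (h.scaledCopy_second_subset _ _)
      · exact (h.scaledCopy_first_subset _ _).trans (h.scaledCopy_third_subset _ _)
    · exact ((h'.sep_middle_last hsx0.le).mono hx' subset_rfl subset_rfl).union_right
        ((h'.sep_middle_Ici hsx0.le).mono hx' subset_rfl hIci)
  · intro x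
    simp only [List.mem_cons, List.not_mem_nil, or_false, exists_eq_or_imp, exists_eq_left]
    rw [h.upperPart_eq_three tx sx]
    simp only [Set.mem_union, or_assoc]
  · intro x
    simp only [List.mem_cons, List.not_mem_nil, or_false, exists_eq_or_imp, exists_eq_left]
    rw [h'.upperPart_eq_three tx' sx]
    simp only [Set.mem_union, or_assoc]

-- Only the first subcopy of the right member reaches the touching point and stays in the pair, with
-- m + 1. The gap behind it frees the rest, which is cut once more into a single copy and a pair.
include h h' hd' hp hθ0 hθ1 hN hκ hr hsx hsy hsx0 hsy0 hsyr hsep hdist htouch hy hy' hxy in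
theorem refines_right (hn : n ≤ q + 1) (hm : m + 2 ≤ p) :
    Refines (ParallelState a b c d d' E E' p q θ κ) θ η
      (upperPart b c d E tx sx ∪ scaledCopy E ty sy,
          upperPart b c d' E' tx' sx ∪ scaledCopy E' ty' sy, θ ^ (n + m + 1) * r) := by
  have ha := h.a_pos
  have hb := h.b_pos
  have hc := h.c_pos
  have hab : b * a ≤ 1 := mul_le_one₀ h.b_lt_one.le ha.le h.a_lt_one.le
  refine ⟨[(upperPart b c d E tx sx ∪ scaledCopy E ty (sy * a),
      upperPart b c d' E' tx' sx ∪ scaledCopy E' ty' (sy * a), θ ^ (n + (m + 1) + 1) * r),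
    (scaledCopy E (ty + sy * d) (sy * b * a), scaledCopy E' (ty' + sy * d') (sy * b * a),
      sy * b * a),
    (upperPart b c d E (ty + sy * d) (sy * b) ∪ scaledCopy E (ty + sy * (1 - c)) (sy * c),
      upperPart b c d' E' (ty' + sy * d') (sy * b) ∪ scaledCopy E' (ty' + sy * (1 - c)) (sy * c),
      θ * sy)], ?_, ?_, ?_, ?_⟩
  · simp only [List.mem_cons, List.not_mem_nil, or_false, forall_eq_or_imp, forall_eq]
    refine ⟨⟨pair r _ _ _ _ _ _ n (m + 1) hr hn hm hsx ?_
        (hsep.mono le_rfl subset_rfl (h.scaledCopy_first_subset _ _)) ?_ htouch, ?_⟩,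
      ⟨single _ _ _ (by positivity), ?_⟩, pair_upper h hκ hd' (by omega) hsy0, ?_⟩
    · rw [hsy]; ring
    · exact fun x hx y hy => hdist x hx y (h.scaledCopy_first_subset _ _ hy)
    · rw [← mul_assoc, ← pow_succ']
      exact le_of_eq (by ring)
    · have : sy * b * a ≤ sy := by
        rw [mul_assoc]; exact mul_le_of_le_one_right hsy0.le hab
      simpa using scale_le hθ0 hθ1 (by positivity) hr.le (this.trans hsyr) 0
        (show n + m + 1 + 1 ≤ N by omega)
    · simpa using scale_le hθ0 hθ1 hsy0.le hr.le hsyr 1 (show n + m + 1 + 1 ≤ N by omega)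
  · simp only [List.pairwise_cons, List.mem_cons, List.not_mem_nil, or_false, forall_eq_or_imp,
      forall_eq, List.Pairwise.nil, IsEmpty.forall_iff, implies_true, and_true]
    have hIic : upperPart b c d' E' tx' sx ⊆ Set.Iic ty' := fun x hx => by
      rw [htouch]; exact (h'.upperPart_bounds hsx0.le hx).2
    have e₁ : upperPart b c d E (ty + sy * d) (sy * b) ∪
        scaledCopy E (ty + sy * (1 - c)) (sy * c) ⊆ upperPart b c d E ty sy := by
      rw [h.upperPart_eq_two ty sy]; exact Set.subset_union_right
    have e₂ : scaledCopy E (ty + sy * d) (sy * b * a) ⊆ upperPart b c d E ty sy := by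
      rw [h.upperPart_eq_two ty sy]; exact Set.subset_union_left
    have e₁' : upperPart b c d' E' (ty' + sy * d') (sy * b) ∪
        scaledCopy E' (ty' + sy * (1 - c)) (sy * c) ⊆ upperPart b c d' E' ty' sy := by
      rw [h'.upperPart_eq_two ty' sy]; exact Set.subset_union_right
    have e₂' : scaledCopy E' (ty' + sy * d') (sy * b * a) ⊆ upperPart b c d' E' ty' sy := by
      rw [h'.upperPart_eq_two ty' sy]; exact Set.subset_union_left
    have k : SeparatedBy (η * (θ ^ (n + m + 1) * r))
        (upperPart b c d E tx sx ∪ scaledCopy E ty (sy * a)) (upperPart b c d E ty sy) :=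
      (hsep.mono hxy (h.upperPart_subset _ _) (h.upperPart_subset _ _)).union_left
        ((h.sep_first_upper hsy0.le).mono hy subset_rfl subset_rfl)
    have k' : SeparatedBy (η * (θ ^ (n + m + 1) * r))
        (upperPart b c d' E' tx' sx ∪ scaledCopy E' ty' (sy * a)) (upperPart b c d' E' ty' sy) :=
      ((h'.sep_Iic_upper hsy0.le).mono hy' hIic subset_rfl).union_left
        ((h'.sep_first_upper hsy0.le).mono hy' subset_rfl subset_rfl)
    exact ⟨⟨⟨k.mono le_rfl subset_rfl e₂, k'.mono le_rfl subset_rfl e₂'⟩,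
      k.mono le_rfl subset_rfl e₁, k'.mono le_rfl subset_rfl e₁'⟩,
      (h.sep_21_tail hsy0.le).mono hy subset_rfl subset_rfl,
      (h'.sep_21_tail hsy0.le).mono hy' subset_rfl subset_rfl⟩
  · intro x
    simp only [List.mem_cons, List.not_mem_nil, or_false, exists_eq_or_imp, exists_eq_left]
    rw [h.scaledCopy_eq ty sy, h.upperPart_eq_two ty sy]
    simp only [Set.mem_union, or_assoc]
  · intro x
    simp only [List.mem_cons, List.not_mem_nil, or_false, exists_eq_or_imp, exists_eq_left]
    rw [h'.scaledCopy_eq ty' sy, h'.upperPart_eq_two ty' sy]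
    simp only [Set.mem_union, or_assoc]

include h h' hd' hθ0 hθ1 hN hκ hr hsx0 hsy0 hsxr hsyr hsep htouch hx hy hx' hy' hxy in
/-- When a copy of the size of the first member of the pair occurs right behind the smallest
subcopy of the second member, the first member is moved there on the side of `E`. -/
theorem refines_swap (hn : n = q + 1) (hm : m + 1 = p) (hq : 1 ≤ p)
    (hsx : sx = sy * b * a) (hsx' : sx = r * a ^ p * b * c ^ 1) (hsya : sy * a = r * a ^ p * c)
    (hrp : r * a ^ p ≤ r * θ ^ N)
    (hκ' : κ ≤ c * IsTernarySet.gapBound a b c d) :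
    Refines (ParallelState a b c d d' E E' p q θ κ) θ η
      (upperPart b c d E tx sx ∪ scaledCopy E ty sy,
          upperPart b c d' E' tx' sx ∪ scaledCopy E' ty' sy, θ ^ (n + m + 1) * r) := by
  have ha := h.a_pos
  have hb := h.b_pos
  have hc := h.c_pos
  have hr' : 0 < r * a ^ p := by positivity
  have hsxle : sx * a ≤ sx := mul_le_of_le_one_right hsx0.le h.a_lt_one.le
  have hsxle' : sx * b * a ≤ sx := by
    rw [mul_assoc]
    exact mul_le_of_le_one_right hsx0.le (mul_le_one₀ h.b_lt_one.le ha.le h.a_lt_one.le)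
  have hg := h.gapBound_pos
  have hsep₁ : SeparatedBy (sy * IsTernarySet.gapBound a b c d)
      (scaledCopy E (ty + sy * d) sx) (scaledCopy E ty (sy * a)) := by
    rw [hsx]
    refine ((h.sep_first_upper hsy0.le).mono le_rfl subset_rfl ?_).symm
    rw [h.upperPart_eq_two ty sy]; exact Set.subset_union_left
  -- On the side of `E`, the subcopy of size `sx` at `ty + sy * d` gives its upper part to the new
  -- pair, replacing that of the old left member. The old upper part is matched with the upper part
  -- of the corresponding subcopy of `E'`, which has the same size; it is cut in two because an
  -- upper part alone is not a state. The first subcopy of the exchanged copy and the tail of the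
  -- right member keep their partners.
  refine ⟨[(upperPart b c d E (ty + sy * d) sx ∪ scaledCopy E ty (sy * a),
      upperPart b c d' E' tx' sx ∪ scaledCopy E' ty' (sy * a), θ ^ (1 + 0 + 1) * (r * a ^ p)),
    (scaledCopy E (ty + sy * d) (sx * a), scaledCopy E' (ty' + sy * d') (sx * a), sx * a),
    (scaledCopy E (tx + sx * d) (sx * b * a),
      scaledCopy E' (ty' + sy * d' + sx * d') (sx * b * a), sx * b * a),
    (upperPart b c d E (tx + sx * d) (sx * b) ∪ scaledCopy E (tx + sx * (1 - c)) (sx * c),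
      upperPart b c d' E' (ty' + sy * d' + sx * d') (sx * b) ∪
        scaledCopy E' (ty' + sy * d' + sx * (1 - c)) (sx * c), θ * sx),
    (upperPart b c d E (ty + sy * d) (sy * b) ∪ scaledCopy E (ty + sy * (1 - c)) (sy * c),
      upperPart b c d' E' (ty' + sy * d') (sy * b) ∪ scaledCopy E' (ty' + sy * (1 - c)) (sy * c),
      θ * sy)], ?_, ?_, ?_, ?_⟩
  · simp only [List.mem_cons, List.not_mem_nil, or_false, forall_eq_or_imp, forall_eq]
    -- The new left member has size (r a^p) b c and the new right member (r a^p) c, so the pair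
    -- restarts on the scale r a^p with n = 1 and m = 0.
    refine ⟨⟨pair (r * a ^ p) _ _ _ _ _ _ 1 0 hr' (by omega) (by omega) hsx' (by rw [hsya]; ring)
        (hsep₁.mono ?_ subset_rfl subset_rfl) ?_ htouch, ?_⟩,
      ⟨single _ _ _ (by positivity), ?_⟩, ⟨single _ _ _ (by positivity), ?_⟩,
      ⟨pair_upper h hκ hd' (by omega) hsx0, ?_⟩, pair_upper h hκ hd' (by omega) hsy0, ?_⟩
    · calc r * a ^ p * κ ≤ r * a ^ p * (c * IsTernarySet.gapBound a b c d) := by gcongr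
        _ = sy * a * IsTernarySet.gapBound a b c d := by rw [hsya]; ring
        _ ≤ sy * IsTernarySet.gapBound a b c d := by
          gcongr; exact mul_le_of_le_one_right hsy0.le h.a_lt_one.le
    · intro x hx y hy
      have hx₁ : x ∈ scaledCopy E ty sy := by
        rw [hsx] at hx
        exact h.scaledCopy_second_subset _ _ (h.scaledCopy_first_subset _ _ hx)
      refine (h.dist_le_of_mem_scaledCopy hsy0.le hx₁ (h.scaledCopy_first_subset _ _ hy)).trans ?_
      rw [le_div_iff₀ ha, hsya]
      exact mul_le_of_le_one_right hr'.le h.c_lt_one.le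
    · exact scale_le hθ0 hθ1 hr'.le hr.le hrp _ (by omega)
    · simpa using scale_le hθ0 hθ1 (by positivity) hr.le (hsxle.trans hsxr) 0
        (show n + m + 1 + 1 ≤ N by omega)
    · simpa using scale_le hθ0 hθ1 (by positivity) hr.le (hsxle'.trans hsxr) 0
        (show n + m + 1 + 1 ≤ N by omega)
    · simpa using scale_le hθ0 hθ1 hsx0.le hr.le hsxr 1 (show n + m + 1 + 1 ≤ N by omega)
    · simpa using scale_le hθ0 hθ1 hsy0.le hr.le hsyr 1 (show n + m + 1 + 1 ≤ N by omega)
  · simp only [List.pairwise_cons, List.mem_cons, List.not_mem_nil, or_false, forall_eq_or_imp,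
      forall_eq, List.Pairwise.nil, IsEmpty.forall_iff, implies_true, and_true]
    have hIic : upperPart b c d' E' tx' sx ⊆ Set.Iic ty' := fun x hx => by
      rw [htouch]; exact (h'.upperPart_bounds hsx0.le hx).2
    have e₁ : upperPart b c d E (ty + sy * d) (sy * b) ∪
        scaledCopy E (ty + sy * (1 - c)) (sy * c) ⊆ upperPart b c d E ty sy := by
      rw [h.upperPart_eq_two ty sy]; exact Set.subset_union_right
    have e₂ : scaledCopy E (ty + sy * d) sx ⊆ upperPart b c d E ty sy := by
      rw [h.upperPart_eq_two ty sy, hsx]; exact Set.subset_union_left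
    have e₁' : upperPart b c d' E' (ty' + sy * d') (sy * b) ∪
        scaledCopy E' (ty' + sy * (1 - c)) (sy * c) ⊆ upperPart b c d' E' ty' sy := by
      rw [h'.upperPart_eq_two ty' sy]; exact Set.subset_union_right
    have e₂' : scaledCopy E' (ty' + sy * d') sx ⊆ upperPart b c d' E' ty' sy := by
      rw [h'.upperPart_eq_two ty' sy, hsx]; exact Set.subset_union_left
    have u := h.upperPart_subset ty sy
    have w₁ : scaledCopy E (tx + sx * d) (sx * b * a) ⊆ scaledCopy E tx sx :=
      (h.scaledCopy_first_subset _ _).trans (h.scaledCopy_second_subset _ _)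
    have w₂ : upperPart b c d E (tx + sx * d) (sx * b) ∪
        scaledCopy E (tx + sx * (1 - c)) (sx * c) ⊆ scaledCopy E tx sx :=
      Set.union_subset ((h.upperPart_subset _ _).trans (h.scaledCopy_second_subset _ _))
        (h.scaledCopy_third_subset _ _)
    have v₁ : scaledCopy E' (ty' + sy * d' + sx * d') (sx * b * a) ⊆
        upperPart b c d' E' (ty' + sy * d') sx := by
      rw [h'.upperPart_eq_two (ty' + sy * d') sx]; exact Set.subset_union_left
    have v₂ : upperPart b c d' E' (ty' + sy * d' + sx * d') (sx * b) ∪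
        scaledCopy E' (ty' + sy * d' + sx * (1 - c)) (sx * c) ⊆
          upperPart b c d' E' (ty' + sy * d') sx := by
      rw [h'.upperPart_eq_two (ty' + sy * d') sx]; exact Set.subset_union_right
    have v := h'.upperPart_subset (ty' + sy * d') sx
    have k₁ : SeparatedBy (η * (θ ^ (n + m + 1) * r))
        (upperPart b c d E (ty + sy * d) sx ∪ scaledCopy E ty (sy * a))
        (scaledCopy E (ty + sy * d) (sx * a)) :=
      ((h.sep_first_upper hsx0.le).symm.mono hx subset_rfl subset_rfl).union_left
        ((h.sep_first_upper hsy0.le).mono hy subset_rfl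
          ((h.scaledCopy_first_subset _ _).trans e₂))
    have k₂ : SeparatedBy (η * (θ ^ (n + m + 1) * r))
        (upperPart b c d E (ty + sy * d) sx ∪ scaledCopy E ty (sy * a))
        (scaledCopy E tx sx) :=
      hsep.symm.mono hxy (Set.union_subset (((h.upperPart_subset _ _).trans e₂).trans u)
        (h.scaledCopy_first_subset _ _)) subset_rfl
    have t₅ : SeparatedBy (η * (θ ^ (n + m + 1) * r)) (scaledCopy E (ty + sy * d) sx)
        (upperPart b c d E (ty + sy * d) (sy * b) ∪
          scaledCopy E (ty + sy * (1 - c)) (sy * c)) := by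
      rw [hsx]; exact (h.sep_21_tail hsy0.le).mono hy subset_rfl subset_rfl
    have t₅' : SeparatedBy (η * (θ ^ (n + m + 1) * r)) (scaledCopy E' (ty' + sy * d') sx)
        (upperPart b c d' E' (ty' + sy * d') (sy * b) ∪
          scaledCopy E' (ty' + sy * (1 - c)) (sy * c)) := by
      rw [hsx]; exact (h'.sep_21_tail hsy0.le).mono hy' subset_rfl subset_rfl
    have k₅ : SeparatedBy (η * (θ ^ (n + m + 1) * r))
        (upperPart b c d E (ty + sy * d) sx ∪ scaledCopy E ty (sy * a))
        (upperPart b c d E (ty + sy * d) (sy * b) ∪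
          scaledCopy E (ty + sy * (1 - c)) (sy * c)) :=
      (t₅.mono le_rfl (h.upperPart_subset _ _) subset_rfl).union_left
        ((h.sep_first_upper hsy0.le).mono hy subset_rfl e₁)
    have k' : SeparatedBy (η * (θ ^ (n + m + 1) * r))
        (upperPart b c d' E' tx' sx ∪ scaledCopy E' ty' (sy * a)) (upperPart b c d' E' ty' sy) :=
      ((h'.sep_Iic_upper hsy0.le).mono hy' hIic subset_rfl).union_left
        ((h'.sep_first_upper hsy0.le).mono hy' subset_rfl subset_rfl)
    have f := h.scaledCopy_first_subset (ty + sy * d) sx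
    have f' := h'.scaledCopy_first_subset (ty' + sy * d') sx
    have s' := (h'.sep_first_upper (t := ty' + sy * d') hsx0.le).mono hx' subset_rfl subset_rfl
    refine ⟨⟨⟨k₁, k'.mono le_rfl subset_rfl (f'.trans e₂')⟩,
      ⟨k₂.mono le_rfl subset_rfl w₁, k'.mono le_rfl subset_rfl ((v₁.trans v).trans e₂')⟩,
      ⟨k₂.mono le_rfl subset_rfl w₂, k'.mono le_rfl subset_rfl ((v₂.trans v).trans e₂')⟩,
      k₅, k'.mono le_rfl subset_rfl e₁'⟩,
      ⟨⟨hsep.symm.mono hxy ((f.trans e₂).trans u) w₁, s'.mono le_rfl subset_rfl v₁⟩,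
      ⟨hsep.symm.mono hxy ((f.trans e₂).trans u) w₂, s'.mono le_rfl subset_rfl v₂⟩,
      t₅.mono le_rfl f subset_rfl, t₅'.mono le_rfl f' subset_rfl⟩,
      ⟨⟨(h.sep_21_tail hsx0.le).mono hx subset_rfl subset_rfl,
        (h'.sep_21_tail hsx0.le).mono hx' subset_rfl subset_rfl⟩,
        hsep.mono hxy w₁ (e₁.trans u), t₅'.mono le_rfl (v₁.trans v) subset_rfl⟩,
      hsep.mono hxy w₂ (e₁.trans u), t₅'.mono le_rfl (v₂.trans v) subset_rfl⟩
  · intro x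
    simp only [List.mem_cons, List.not_mem_nil, or_false, exists_eq_or_imp, exists_eq_left]
    rw [h.upperPart_eq_two tx sx, h.scaledCopy_eq ty sy, h.upperPart_eq_two ty sy, ← hsx,
      h.scaledCopy_eq (ty + sy * d) sx]
    simp only [Set.mem_union]
    tauto
  · intro x
    simp only [List.mem_cons, List.not_mem_nil, or_false, exists_eq_or_imp, exists_eq_left]
    rw [h'.scaledCopy_eq ty' sy, h'.upperPart_eq_two ty' sy, ← hsx,
      h'.scaledCopy_eq (ty' + sy * d') sx, h'.upperPart_eq_two (ty' + sy * d') sx]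
    simp only [Set.mem_union]
    tauto

end Pair

end ParallelState

/-! ### Compactness and size of the states -/

namespace ParallelState

variable {a b c d d' : ℝ} {E E' : Set ℝ} {p q : ℕ} {θ κ : ℝ}

theorem isCompact_both (h : IsTernarySet a b c d E) (h' : IsTernarySet a b c d' E')
    {S : Set ℝ × Set ℝ × ℝ} (hS : ParallelState a b c d d' E E' p q θ κ S) :
    IsCompact S.1 ∧ IsCompact S.2.1 := by
  cases hS with
  | single t t' s hs => exact ⟨h.isCompact_scaledCopy _ _, h'.isCompact_scaledCopy _ _⟩
  | pair r tx ty tx' ty' sx sy n m hr hn hm hsx hsy hsep hdist htouch =>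
    exact ⟨(h.isCompact_upperPart _ _).union (h.isCompact_scaledCopy _ _),
      (h'.isCompact_upperPart _ _).union (h'.isCompact_scaledCopy _ _)⟩

theorem nonempty (h : IsTernarySet a b c d E) (h' : IsTernarySet a b c d' E')
    {S : Set ℝ × Set ℝ × ℝ} (hS : ParallelState a b c d d' E E' p q θ κ S) :
    S.1.Nonempty ∧ S.2.1.Nonempty := by
  cases hS with
  | single t t' s hs => exact ⟨h.scaledCopy_nonempty _ _, h'.scaledCopy_nonempty _ _⟩
  | pair r tx ty tx' ty' sx sy n m hr hn hm hsx hsy hsep hdist htouch =>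
    exact ⟨(h.scaledCopy_nonempty _ _).inr, (h'.scaledCopy_nonempty _ _).inr⟩

/-- Distances within a pair are at most r / a + 2 r: across the members in `E` by the bound carried
by the pair, and in `E'` because the two members lie in adjacent intervals. The denominator θ^N
makes up for the factor θ^(n + m + 1) in the scale. -/
theorem dist_le (h : IsTernarySet a b c d E) (h' : IsTernarySet a b c d' E')
    (hθ0 : 0 < θ) (hθ1 : θ < 1) {N : ℕ} (hN : p + q + 3 ≤ N)
    {S : Set ℝ × Set ℝ × ℝ} (hS : ParallelState a b c d d' E E' p q θ κ S) :
    (∀ x ∈ S.1, ∀ y ∈ S.1, dist x y ≤ (1 / a + 2) / θ ^ N * S.2.2) ∧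
      ∀ x ∈ S.2.1, ∀ y ∈ S.2.1, dist x y ≤ (1 / a + 2) / θ ^ N * S.2.2 := by
  have ha := h.a_pos
  have hb := h.b_pos
  have hc := h.c_pos
  have hθN : 0 < θ ^ N := by positivity
  have ha1 : 0 < 1 / a := by positivity
  have key : ∀ r σ : ℝ, 0 < r → θ ^ N * r ≤ σ → r / a + 2 * r ≤ (1 / a + 2) / θ ^ N * σ := by
    intro r σ hr hσ
    rw [div_mul_eq_mul_div, le_div_iff₀ hθN]
    calc (r / a + 2 * r) * θ ^ N = (1 / a + 2) * (θ ^ N * r) := by ring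
      _ ≤ _ := by gcongr
  cases hS with
  | single t t' s hs =>
    have hk := key s s hs (mul_le_of_le_one_left hs.le (pow_le_one₀ hθ0.le hθ1.le))
    have : s ≤ s / a + 2 * s := by
      have : 0 < s / a := by positivity
      linarith
    exact ⟨fun x hx y hy => ((h.dist_le_of_mem_scaledCopy hs.le hx hy).trans this).trans hk,
      fun x hx y hy => ((h'.dist_le_of_mem_scaledCopy hs.le hx hy).trans this).trans hk⟩
  | pair r tx ty tx' ty' sx sy n m hr hn hm hsx hsy hsep hdist htouch =>
    have hk := key r (θ ^ (n + m + 1) * r) hr (mul_le_mul_of_nonneg_right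
      (pow_le_pow_of_le_one hθ0.le hθ1.le (by omega)) hr.le)
    have hra : 0 < r / a := by positivity
    have hsx0 : 0 < sx := by rw [hsx]; positivity
    have hsy0 : 0 < sy := by rw [hsy]; positivity
    have hsxr : sx ≤ r := by
      rw [hsx, mul_assoc]
      exact mul_le_of_le_one_right hr.le
        (mul_le_one₀ h.b_lt_one.le (by positivity) (pow_le_one₀ hc.le h.c_lt_one.le))
    have hsyr : sy ≤ r := by
      rw [hsy, mul_assoc]
      exact mul_le_of_le_one_right hr.le
        (mul_le_one₀ h.c_lt_one.le (by positivity) (pow_le_one₀ ha.le h.a_lt_one.le))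
    refine ⟨fun x hx y hy => le_trans ?_ hk, fun x hx y hy => le_trans ?_ hk⟩
    · rcases hx with hx | hx <;> rcases hy with hy | hy
      · have := h.dist_le_of_mem_scaledCopy hsx0.le (h.upperPart_subset _ _ hx)
          (h.upperPart_subset _ _ hy)
        linarith
      · have := hdist x (h.upperPart_subset _ _ hx) y hy
        linarith
      · have := hdist y (h.upperPart_subset _ _ hy) x hx
        rw [dist_comm] at this
        linarith
      · have := h.dist_le_of_mem_scaledCopy hsy0.le hx hy
        linarith
    · have hmem : ∀ z ∈ upperPart b c d' E' tx' sx ∪ scaledCopy E' ty' sy,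
          z ∈ Set.Icc tx' (tx' + sx + sy) := by
        rintro z (hz | hz)
        · have := h'.scaledCopy_bounds hsx0.le (h'.upperPart_subset _ _ hz)
          constructor <;> linarith
        · have := h'.scaledCopy_bounds hsy0.le hz
          rw [htouch] at this
          constructor <;> linarith
      have := Real.dist_le_of_mem_Icc (hmem x hx) (hmem y hy)
      linarith

end ParallelState

/-! ### Sufficiency for ternary sets -/

theorem exists_root_bound {a b c : ℝ} (ha : 0 < a) (ha1 : a < 1) (hb1 : b < 1) (hc1 : c < 1)
    {N : ℕ} (hN : N ≠ 0) : ∃ θ : ℝ, 0 < θ ∧ θ < 1 ∧ a ≤ θ ^ N ∧ b ≤ θ ^ N ∧ c ≤ θ ^ N := by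
  have hM : 0 < max a (max b c) := lt_max_of_lt_left ha
  refine ⟨max a (max b c) ^ ((N : ℝ)⁻¹), Real.rpow_pos_of_pos hM _,
    Real.rpow_lt_one hM.le (max_lt ha1 (max_lt hb1 hc1)) (by positivity), ?_⟩
  rw [Real.rpow_inv_natCast_pow hM.le hN]
  exact ⟨le_max_left _ _, (le_max_left _ _).trans (le_max_right _ _),
    (le_max_right _ _).trans (le_max_right _ _)⟩

open ParallelState IsTernarySet in
/-- A ternary set with gaps on both sides of its middle piece is Lipschitz equivalent to the one with
touching second and third pieces, if the outer ratios have a common power. -/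
theorem IsTernarySet.lipschitzEquivalent {a b c d d' : ℝ} {E E' : Set ℝ} {p q : ℕ}
    (h : IsTernarySet a b c d E) (h' : IsTernarySet a b c d' E') (hd : d < 1 - b - c)
    (hd' : d' = 1 - b - c) (hp : 2 ≤ p) (hpq : a ^ p = c ^ q) : LipschitzEquivalent E E' := by
  have ha := h.a_pos
  have hb := h.b_pos
  have hc := h.c_pos
  -- The exponent p + q + 3 exceeds n + m + 2 for all admissible n and m, as `scale_le` requires.
  obtain ⟨θ, hθ0, hθ1, haθ, hbθ, hcθ⟩ := exists_root_bound (N := p + q + 3) ha h.a_lt_one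
    h.b_lt_one h.c_lt_one (by omega)
  have hθN : θ ^ (p + q + 3) ≤ θ := pow_le_of_le_one hθ0.le hθ1.le (by omega)
  have hg := h.gapBound_pos
  have hg' := h'.gapBound_pos
  -- The first bound is the relative gap in `E` between the members of a fresh pair, the second
  -- serves the swapped pair.
  obtain ⟨κ, hκ0, hκ, hκ'⟩ : ∃ κ : ℝ, 0 < κ ∧ κ ≤ 1 - c - d - b ∧ κ ≤ c * gapBound a b c d :=
    ⟨min (1 - c - d - b) (c * gapBound a b c d), lt_min (by linarith) (by positivity),
      min_le_left _ _, min_le_right _ _⟩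
  -- ω bounds the sizes of both members of a pair relative to r from below, because n ≤ q + 1 and m
  -- < p.
  obtain ⟨ω, hω0, hω1, hωx, hωy⟩ : ∃ ω : ℝ, 0 < ω ∧ ω ≤ 1 ∧ ω ≤ b * c ^ (q + 1) ∧ ω ≤ c * a ^ p :=
    ⟨min (b * c ^ (q + 1)) (c * a ^ p), lt_min (by positivity) (by positivity),
      (min_le_right _ _).trans
        (mul_le_one₀ h.c_lt_one.le (by positivity) (pow_le_one₀ ha.le h.a_lt_one.le)),
      min_le_left _ _, min_le_right _ _⟩
  obtain ⟨η, hη0, hηκ, hη, hη'⟩ : ∃ η : ℝ, 0 < η ∧ η ≤ κ ∧ η ≤ ω * gapBound a b c d ∧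
      η ≤ ω * gapBound a b c d' :=
    ⟨min κ (min (ω * gapBound a b c d) (ω * gapBound a b c d')),
      lt_min hκ0 (lt_min (by positivity) (by positivity)), min_le_left _ _,
      (min_le_right _ _).trans (min_le_left _ _), (min_le_right _ _).trans (min_le_right _ _)⟩
  have start : ParallelState a b c d d' E E' p q θ κ (E, E', 1) := by
    have := single (a := a) (b := b) (c := c) (d := d) (d' := d') (E := E) (E' := E') (p := p)
      (q := q) (θ := θ) (κ := κ) 0 0 1 one_pos
    simpa [scaledCopy] using this
  refine lipschitzEquivalent_of_refinement (ParallelState a b c d d' E E' p q θ κ) θ η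
    ((1 / a + 2) / θ ^ (p + q + 3)) hθ0.le hθ1 hη0 (by positivity)
    (fun S hS => isCompact_both h h' hS) (fun S hS => nonempty h h' hS)
    (fun S hS => dist_le h h' hθ0 hθ1 le_rfl hS) ?_ start
  intro S hS
  cases hS with
  | single t t' s hs =>
    exact refines_single h h' hd' hp (haθ.trans hθN) (hbθ.trans hθN) hκ
      (hη.trans (mul_le_of_le_one_left hg.le hω1)) (hη'.trans (mul_le_of_le_one_left hg'.le hω1))
      t t' s hs
  | pair r tx ty tx' ty' sx sy n m hr hn hm hsx hsy hsep hdist htouch =>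
    have hsx0 : 0 < sx := by rw [hsx]; positivity
    have hsy0 : 0 < sy := by rw [hsy]; positivity
    have hsxω : r * ω ≤ sx := by
      rw [hsx, mul_assoc]
      have : c ^ (q + 1) ≤ c ^ n := pow_le_pow_of_le_one hc.le h.c_lt_one.le hn
      exact mul_le_mul_of_nonneg_left (hωx.trans (by gcongr)) hr.le
    have hsyω : r * ω ≤ sy := by
      rw [hsy, mul_assoc]
      have : a ^ p ≤ a ^ m := pow_le_pow_of_le_one ha.le h.a_lt_one.le (by omega)
      exact mul_le_mul_of_nonneg_left (hωy.trans (by gcongr)) hr.le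
    have hsxr : sx ≤ r * θ ^ (p + q + 3) := by
      rw [hsx, mul_assoc]
      refine mul_le_mul_of_nonneg_left (le_trans ?_ hbθ) hr.le
      exact mul_le_of_le_one_right hb.le (pow_le_one₀ hc.le h.c_lt_one.le)
    have hsyr : sy ≤ r * θ ^ (p + q + 3) := by
      rw [hsy, mul_assoc]
      refine mul_le_mul_of_nonneg_left (le_trans ?_ hcθ) hr.le
      exact mul_le_of_le_one_right hc.le (pow_le_one₀ ha.le h.a_lt_one.le)
    have hσ : θ ^ (n + m + 1) * r ≤ r :=
      mul_le_of_le_one_left hr.le (pow_le_one₀ hθ0.le hθ1.le)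
    have bd : ∀ g s : ℝ, 0 < g → η ≤ ω * g → r * ω ≤ s → η * (θ ^ (n + m + 1) * r) ≤ s * g := by
      intro g s hg hηg hs
      calc η * (θ ^ (n + m + 1) * r) ≤ ω * g * r := by gcongr
        _ = r * ω * g := by ring
        _ ≤ s * g := by gcongr
    have hx := bd _ sx hg hη hsxω
    have hy := bd _ sy hg hη hsyω
    have hx' := bd _ sx hg' hη' hsxω
    have hy' := bd _ sy hg' hη' hsyω
    have hxy : η * (θ ^ (n + m + 1) * r) ≤ r * κ := by
      rw [mul_comm r κ]; gcongr
    -- The left member is exhausted first, then the right one; the swap is needed only for n = q + 1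
    -- and m = p - 1.
    by_cases hnq : n ≤ q
    · exact refines_left h h' hd' hp hθ0 hθ1.le le_rfl hκ hr hm hsx hsy hsx0 hsy0 hsxr hsep hdist
        htouch hx hx' hxy hnq
    by_cases hmp : m + 2 ≤ p
    · exact refines_right h h' hd' hp hθ0 hθ1.le le_rfl hκ hr hsx hsy hsx0 hsy0 hsyr hsep hdist
        htouch hy hy' hxy hn hmp
    have hn' : n = q + 1 := by omega
    have hm' : m + 1 = p := by omega
    have hsya : sy * a = r * a ^ p * c := by rw [hsy, ← hm']; ring
    -- This is where a^p = c^q is used: c^(q + 1) = a^p c.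
    have hsx' : sx = r * a ^ p * b * c ^ 1 := by rw [hsx, hn', hpq]; ring
    refine refines_swap h h' hd' hθ0 hθ1.le le_rfl hκ hr hsx0 hsy0 hsxr hsyr hsep htouch hx hx'
      hy hy' hxy hn' hm' (by omega) ?_ hsx' hsya ?_ hκ'
    · calc sx = r * a ^ p * c * b := by rw [hsx']; ring
        _ = sy * b * a := by rw [← hsya]; ring
    · exact mul_le_mul_of_nonneg_left
        ((pow_le_of_le_one ha.le h.a_lt_one.le (by omega)).trans haθ) hr.le

/-! ### Attractors as ternary sets; the sufficiency direction -/

section Attractor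

variable {n : ℕ} {ρ t : Fin n → ℝ} {hρ : IsContractionVector ρ} {E : Set ℝ}

theorem mem_attractor_iff (hE : (affineIFS ρ hρ t).IsAttractor E) (x : ℝ) :
    x ∈ E ↔ ∃ i, ∃ y ∈ E, ρ i * y + t i = x := by
  conv_lhs => rw [← hE.2.2]
  simp only [Set.mem_iUnion, Set.mem_image]
  rfl

theorem attractor_subset_Icc (hE : (affineIFS ρ hρ t).IsAttractor E) (h0 : ∀ i, 0 ≤ t i)
    (h1 : ∀ i, t i ≤ 1 - ρ i) : E ⊆ Set.Icc 0 1 := by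
  obtain ⟨M, hM, hmax⟩ := hE.2.1.exists_isMaxOn hE.1 continuousOn_id
  obtain ⟨m, hm, hmin⟩ := hE.2.1.exists_isMinOn hE.1 continuousOn_id
  have hM1 : M ≤ 1 := by
    obtain ⟨i, y, hy, hyM⟩ := (mem_attractor_iff hE M).1 hM
    have h₁ : y ≤ M := hmax hy
    have h₂ := mul_le_mul_of_nonneg_left h₁ (hρ.pos i).le
    have h₃ := hρ.lt_one i
    have h₄ := h1 i
    by_contra hlt
    nlinarith [not_le.1 hlt]
  have hm0 : 0 ≤ m := by
    obtain ⟨i, y, hy, hym⟩ := (mem_attractor_iff hE m).1 hm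
    have h₁ : m ≤ y := hmin hy
    have h₂ := mul_le_mul_of_nonneg_left h₁ (hρ.pos i).le
    have h₃ := hρ.lt_one i
    have h₄ := h0 i
    by_contra hlt
    nlinarith [not_le.1 hlt]
  intro x hx
  have h₁ : x ≤ M := hmax hx
  have h₂ : m ≤ x := hmin hx
  exact ⟨hm0.trans h₂, h₁.trans hM1⟩

/-- Iterating one map from any point of the closed set converges to its fixed point. -/
theorem fixedPoint_mem_attractor (hE : (affineIFS ρ hρ t).IsAttractor E) (i : Fin n) {x : ℝ}
    (hx : ρ i * x + t i = x) : x ∈ E := by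
  obtain ⟨y, hy⟩ := hE.1
  have key : ∀ k : ℕ, x + ρ i ^ k * (y - x) ∈ E := by
    intro k
    induction k with
    | zero => simpa using hy
    | succ k ih =>
      refine (mem_attractor_iff hE _).2 ⟨i, _, ih, ?_⟩
      rw [pow_succ]
      linear_combination hx
  have hlim : Filter.Tendsto (fun k : ℕ => x + ρ i ^ k * (y - x)) Filter.atTop (nhds x) := by
    simpa using ((tendsto_pow_atTop_nhds_zero_of_lt_one (hρ.pos i).le (hρ.lt_one i)).mul_const
      (y - x)).const_add x
  exact hE.2.1.isClosed.mem_of_tendsto hlim (Filter.Eventually.of_forall key)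

end Attractor

theorem isTernarySet_of_isAttractor {ρ : Fin 3 → ℝ} {hρ : IsContractionVector ρ} {d : ℝ}
    (hd : ρ 0 < d) (hd' : d ≤ 1 - ρ 1 - ρ 2) {E : Set ℝ}
    (hE : (affineIFS ρ hρ ![0, d, 1 - ρ 2]).IsAttractor E) :
    IsTernarySet (ρ 0) (ρ 1) (ρ 2) d E where
  a_pos := hρ.pos 0
  b_pos := hρ.pos 1
  c_pos := hρ.pos 2
  a_lt := hd
  d_le := hd'
  isCompact := hE.2.1
  zero_mem := fixedPoint_mem_attractor hE 0 (by simp)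
  one_mem := fixedPoint_mem_attractor hE 2 (by simp)
  subset_Icc := by
    have h0 := hρ.pos 0
    have h2 := hρ.lt_one 2
    have h2' := hρ.pos 2
    have h0' := hρ.lt_one 0
    refine attractor_subset_Icc hE (fun i => ?_) fun i => ?_
    · fin_cases i <;> simp <;> linarith
    · fin_cases i <;> simp <;> linarith
  mem_iff x := by
    rw [mem_attractor_iff hE]
    constructor
    · rintro ⟨i, y, hy, rfl⟩
      fin_cases i
      · exact Or.inl ⟨y, hy, by simp⟩
      · exact Or.inr (Or.inl ⟨y, hy, by simp⟩)
      · exact Or.inr (Or.inr ⟨y, hy, by simp⟩)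
    · rintro (⟨y, hy, rfl⟩ | ⟨y, hy, rfl⟩ | ⟨y, hy, rfl⟩)
      · exact ⟨0, y, hy, by simp⟩
      · exact ⟨1, y, hy, by simp⟩
      · exact ⟨2, y, hy, by simp⟩

theorem exists_pow_eq_pow_of_log_div_log {a c : ℝ} (ha : 0 < a) (ha1 : a < 1) (hc : 0 < c)
    (hc1 : c < 1) {r : ℚ} (hr : Real.log a / Real.log c = r) :
    ∃ p q : ℕ, 2 ≤ p ∧ a ^ p = c ^ q := by
  have hla := Real.log_neg ha ha1
  have hlc := Real.log_neg hc hc1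
  have hr0 : 0 < r := by
    have : (0 : ℝ) < r := by rw [← hr]; exact div_pos_of_neg_of_neg hla hlc
    exact_mod_cast this
  -- Numerator and denominator are doubled to guarantee an exponent p ≥ 2.
  refine ⟨2 * r.den, 2 * r.num.natAbs, by have := r.den_pos; omega, ?_⟩
  refine Real.log_injOn_pos (pow_pos ha _) (pow_pos hc _) ?_
  have hnum : ((r.num.natAbs : ℕ) : ℝ) = r.num := by
    rw [Nat.cast_natAbs, abs_of_nonneg (Rat.num_nonneg.2 hr0.le)]
  have hrr : (r : ℝ) = r.num / r.den := by exact_mod_cast (Rat.num_div_den r).symm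
  have hden : (r.den : ℝ) ≠ 0 := by exact_mod_cast r.den_ne_zero
  rw [hrr, div_eq_div_iff hlc.ne hden] at hr
  rw [Real.log_pow, Real.log_pow]
  push_cast
  rw [hnum]
  linarith

theorem lipschitzEquivalent_of_log_div_log (ρ : Fin 3 → ℝ) (hρ : IsContractionVector ρ)
    (d₂ : ℝ) (hd₂ : ρ 0 < d₂) (hd₂' : d₂ < 1 - ρ 1 - ρ 2) {r : ℚ}
    (hr : Real.log (ρ 0) / Real.log (ρ 2) = r) :
    LipschitzEquivalent (separatedSet ρ hρ d₂) (touchingSet ρ hρ) := by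
  obtain ⟨p, q, hp, hpq⟩ := exists_pow_eq_pow_of_log_div_log (hρ.pos 0) (hρ.lt_one 0) (hρ.pos 2)
    (hρ.lt_one 2) hr
  exact (isTernarySet_of_isAttractor hd₂ hd₂'.le
    (SimilitudeIFS.isAttractor_attractor _)).lipschitzEquivalent
    (isTernarySet_of_isAttractor (hd₂.trans hd₂') le_rfl (SimilitudeIFS.isAttractor_attractor _))
    hd₂' rfl hp hpq

/-! ### A self-similar content -/

section Content

variable {ι X : Type*} [Fintype ι]

open Classical in
/-- The total weight of the level-`n` cylinders of `E` met by `K`. -/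
noncomputable def levelContent (φ : ι → X → X) (u : ι → ℝ) (E : Set X) : ℕ → Set X → ℝ
  | 0, K => if (K ∩ E).Nonempty then 1 else 0
  | n + 1, K => ∑ i, u i * levelContent φ u E n (φ i ⁻¹' K)

/-- The level contents decrease with the level, because the maps send `E` into itself; their limit
satisfies the scaling identity exactly, since passing from level n to n + 1 is that identity. It
plays the part of a self-similar measure: finite subadditivity and exact scaling suffice below. -/
theorem exists_selfSimilar_content {φ : ι → X → X} {u : ι → ℝ} {E : Set X} (hE : E.Nonempty)
    (hφ : ∀ i, ∀ x ∈ E, φ i x ∈ E) (hu : ∀ i, 0 ≤ u i) (hsum : ∑ i, u i = 1) :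
    ∃ μ : Set X → ℝ, (∀ K, μ K ≤ 1) ∧ (∀ K L, μ (K ∪ L) ≤ μ K + μ L) ∧
      (∀ K, Disjoint K E → μ K = 0) ∧ (∀ K, E ⊆ K → μ K = 1) ∧
      ∀ K, μ K = ∑ i, u i * μ (φ i ⁻¹' K) := by
  classical
  let m := levelContent φ u E
  have hm0 : ∀ n K, 0 ≤ m n K := by
    intro n
    induction n with
    | zero => intro K; simp only [m, levelContent]; split_ifs <;> norm_num
    | succ n ih => intro K; exact Finset.sum_nonneg fun i _ => mul_nonneg (hu i) (ih _)
  have hm1 : ∀ n K, m n K ≤ 1 := by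
    intro n
    induction n with
    | zero => intro K; simp only [m, levelContent]; split_ifs <;> norm_num
    | succ n ih =>
      intro K
      rw [← hsum]
      exact Finset.sum_le_sum fun i _ => mul_le_of_le_one_right (hu i) (ih _)
  have hanti : ∀ n K, m (n + 1) K ≤ m n K := by
    intro n
    induction n with
    | zero =>
      intro K
      by_cases hK : (K ∩ E).Nonempty
      · have : m 0 K = 1 := if_pos hK
        rw [this]; exact hm1 _ _
      · have h0 : m 0 K = 0 := if_neg hK
        rw [h0]
        refine le_of_eq (Finset.sum_eq_zero fun i _ => ?_)
        have : levelContent φ u E 0 (φ i ⁻¹' K) = 0 :=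
          if_neg fun ⟨x, hx, hxE⟩ => hK ⟨φ i x, hx, hφ i x hxE⟩
        rw [this, mul_zero]
    | succ n ih =>
      intro K
      exact Finset.sum_le_sum fun i _ => mul_le_mul_of_nonneg_left (ih _) (hu i)
  have hsub : ∀ n K L, m n (K ∪ L) ≤ m n K + m n L := by
    intro n
    induction n with
    | zero =>
      intro K L
      by_cases hK : ((K ∪ L) ∩ E).Nonempty
      · have h1 : m 0 (K ∪ L) = 1 := if_pos hK
        obtain ⟨x, hx | hx, hxE⟩ := hK
        · have : m 0 K = 1 := if_pos ⟨x, hx, hxE⟩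
          rw [h1, this]; linarith [hm0 0 L]
        · have : m 0 L = 1 := if_pos ⟨x, hx, hxE⟩
          rw [h1, this]; linarith [hm0 0 K]
      · have h0 : m 0 (K ∪ L) = 0 := if_neg hK
        rw [h0]; exact add_nonneg (hm0 _ _) (hm0 _ _)
    | succ n ih =>
      intro K L
      change ∑ i, u i * m n (φ i ⁻¹' (K ∪ L)) ≤
        ∑ i, u i * m n (φ i ⁻¹' K) + ∑ i, u i * m n (φ i ⁻¹' L)
      rw [← Finset.sum_add_distrib]
      refine Finset.sum_le_sum fun i _ => ?_
      rw [← mul_add]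
      exact mul_le_mul_of_nonneg_left (ih _ _) (hu i)
  have hdisj : ∀ n K, Disjoint K E → m n K = 0 := by
    intro n
    induction n with
    | zero => intro K hK; exact if_neg fun h => Set.not_disjoint_iff_nonempty_inter.2 h hK
    | succ n ih =>
      intro K hK
      refine Finset.sum_eq_zero fun i _ => ?_
      have : m n (φ i ⁻¹' K) = 0 := ih _ (Set.disjoint_left.2 fun x hx hxE =>
        Set.disjoint_left.1 hK hx (hφ i x hxE))
      change u i * m n (φ i ⁻¹' K) = 0
      rw [this, mul_zero]
  have hfull : ∀ n K, E ⊆ K → m n K = 1 := by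
    intro n
    induction n with
    | zero => intro K hK; obtain ⟨x, hx⟩ := hE; exact if_pos ⟨x, hK hx, hx⟩
    | succ n ih =>
      intro K hK
      rw [← hsum]
      refine Finset.sum_congr rfl fun i _ => ?_
      have : m n (φ i ⁻¹' K) = 1 := ih _ fun x hx => hK (hφ i x hx)
      change u i * m n (φ i ⁻¹' K) = u i
      rw [this, mul_one]
  have hlim : ∀ K, ∃ l, Filter.Tendsto (fun n => m n K) Filter.atTop (nhds l) := fun K =>
    ⟨_, tendsto_atTop_ciInf (antitone_nat_of_succ_le fun n => hanti n K)
      ⟨0, by rintro _ ⟨n, rfl⟩; exact hm0 n K⟩⟩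
  choose μ hμ using hlim
  refine ⟨μ, fun K => le_of_tendsto' (hμ K) fun n => hm1 n K,
    fun K L => le_of_tendsto_of_tendsto' (hμ _) ((hμ K).add (hμ L)) fun n => hsub n K L,
    fun K hK => tendsto_nhds_unique (hμ K) (by simp [hdisj _ K hK]),
    fun K hK => tendsto_nhds_unique (hμ K) (by simp [hfull _ K hK]), fun K => ?_⟩
  exact tendsto_nhds_unique ((hμ K).comp (Filter.tendsto_add_atTop_nat 1))
    (tendsto_finsetSum _ fun i _ => (hμ (φ i ⁻¹' K)).const_mul (u i))

/-- The possible contents of unions of level-`D` cylinders. -/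
def contentValues (u : ι → ℝ) : ℕ → Set ℝ
  | 0 => {0, 1}
  | D + 1 => (fun x : ι → ℝ => ∑ i, u i * x i) '' {x | ∀ i, x i ∈ contentValues u D}

theorem finite_contentValues (u : ι → ℝ) (D : ℕ) : (contentValues u D).Finite := by
  induction D with
  | zero => exact (Set.finite_singleton 1).insert 0
  | succ D ih => exact (Set.Finite.pi' fun _ => ih).image _

end Content

/-! ### Words, cylinders and separated self-similar sets -/

section Words

variable {k : ℕ} (ρ t : Fin k → ℝ)

/-- The composition of the maps `x ↦ ρ i * x + t i` along a word. -/
def wordMap (w : List (Fin k)) (x : ℝ) : ℝ := w.foldr (fun i y => ρ i * y + t i) x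

/-- The product of the weights along a word. -/
def wordRatio (w : List (Fin k)) : ℝ := (w.map ρ).prod

@[simp] theorem wordMap_nil (x : ℝ) : wordMap ρ t [] x = x := rfl

@[simp] theorem wordMap_cons (i : Fin k) (w : List (Fin k)) (x : ℝ) :
    wordMap ρ t (i :: w) x = ρ i * wordMap ρ t w x + t i := rfl

theorem wordMap_append (v w : List (Fin k)) (x : ℝ) :
    wordMap ρ t (v ++ w) x = wordMap ρ t v (wordMap ρ t w x) := by
  simp [wordMap]

@[simp] theorem wordRatio_nil : wordRatio ρ [] = 1 := rfl

@[simp] theorem wordRatio_cons (i : Fin k) (w : List (Fin k)) :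
    wordRatio ρ (i :: w) = ρ i * wordRatio ρ w := by simp [wordRatio]

theorem wordRatio_append (v w : List (Fin k)) :
    wordRatio ρ (v ++ w) = wordRatio ρ v * wordRatio ρ w := by simp [wordRatio]

theorem wordRatio_replicate (i : Fin k) (n : ℕ) :
    wordRatio ρ (List.replicate n i) = ρ i ^ n := by simp [wordRatio]

variable {ρ t}

theorem wordRatio_pos (hρ : ∀ i, 0 < ρ i) (w : List (Fin k)) : 0 < wordRatio ρ w := by
  induction w with
  | nil => simp
  | cons i w ih => rw [wordRatio_cons]; exact mul_pos (hρ i) ih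

theorem wordRatio_rpow (hρ : ∀ i, 0 < ρ i) (s : ℝ) (w : List (Fin k)) :
    wordRatio (fun i => ρ i ^ s) w = wordRatio ρ w ^ s := by
  induction w with
  | nil => simp
  | cons i w ih =>
    rw [wordRatio_cons, wordRatio_cons, ih, Real.mul_rpow (hρ i).le (wordRatio_pos hρ w).le]

theorem wordRatio_le_pow (hρ : ∀ i, 0 < ρ i) {b : ℝ} (hb : ∀ i, ρ i ≤ b) (w : List (Fin k)) :
    wordRatio ρ w ≤ b ^ w.length := by
  induction w with
  | nil => simp
  | cons i w ih =>
    rw [wordRatio_cons, List.length_cons, pow_succ']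
    exact mul_le_mul (hb i) ih (wordRatio_pos hρ w).le ((hρ i).le.trans (hb i))

theorem wordMap_sub (w : List (Fin k)) (x y : ℝ) :
    wordMap ρ t w x - wordMap ρ t w y = wordRatio ρ w * (x - y) := by
  induction w with
  | nil => simp
  | cons i w ih => simp only [wordMap_cons, wordRatio_cons]; linear_combination ρ i * ih

theorem abs_wordMap_sub (hρ : ∀ i, 0 < ρ i) (w : List (Fin k)) (x y : ℝ) :
    |wordMap ρ t w x - wordMap ρ t w y| = wordRatio ρ w * |x - y| := by
  rw [wordMap_sub, abs_mul, abs_of_pos (wordRatio_pos hρ w)]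

theorem wordMap_mem {E : Set ℝ} (hE : ∀ i, ∀ x ∈ E, ρ i * x + t i ∈ E) (w : List (Fin k)) {x : ℝ}
    (hx : x ∈ E) : wordMap ρ t w x ∈ E := by
  induction w with
  | nil => exact hx
  | cons i w ih => exact hE i _ ih

end Words

/-- `E` satisfies `E = ⋃ i, (ρ i * E + t i)`, where the sets on the right have mutual distances at
least `δ`. -/
structure IsSeparatedSelfSimilar {k : ℕ} (ρ t : Fin k → ℝ) (δ : ℝ) (E : Set ℝ) : Prop where
  pos : ∀ i, 0 < ρ i
  lt_one : ∀ i, ρ i < 1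
  δ_pos : 0 < δ
  mem_iff : ∀ x, x ∈ E ↔ ∃ i, ∃ y ∈ E, ρ i * y + t i = x
  sep : ∀ i j, i ≠ j → ∀ x ∈ E, ∀ y ∈ E, δ ≤ |ρ i * x + t i - (ρ j * y + t j)|

namespace IsSeparatedSelfSimilar

variable {k : ℕ} {ρ t : Fin k → ℝ} {δ : ℝ} {E : Set ℝ}

theorem map_mem (h : IsSeparatedSelfSimilar ρ t δ E) (i : Fin k) (x : ℝ) (hx : x ∈ E) :
    ρ i * x + t i ∈ E := (h.mem_iff _).2 ⟨i, x, hx, rfl⟩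

theorem wordRatio_le_one (h : IsSeparatedSelfSimilar ρ t δ E) (w : List (Fin k)) :
    wordRatio ρ w ≤ 1 := by
  simpa using wordRatio_le_pow h.pos (fun i => (h.lt_one i).le) w

/-- At the first letter where the address of y leaves w, the distance is at least δ times the ratio
of the common prefix, hence at least δ times the ratio of w. -/
theorem mem_cylinder_of_abs_sub_lt (h : IsSeparatedSelfSimilar ρ t δ E) (w : List (Fin k)) :
    ∀ {x y : ℝ}, x ∈ E → y ∈ E → |wordMap ρ t w x - y| < δ * wordRatio ρ w →
      y ∈ wordMap ρ t w '' E := by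
  induction w with
  | nil => intro x y _ hy _; exact ⟨y, hy, rfl⟩
  | cons i w ih =>
    intro x y hx hy hxy
    obtain ⟨j, y, hy', rfl⟩ := (h.mem_iff y).1 hy
    by_cases hij : i = j
    · subst hij
      rw [wordMap_cons, wordRatio_cons] at hxy
      have h₁ : ρ i * wordMap ρ t w x + t i - (ρ i * y + t i) =
          ρ i * (wordMap ρ t w x - y) := by ring
      rw [h₁, abs_mul, abs_of_pos (h.pos i), mul_left_comm, mul_lt_mul_iff_right₀ (h.pos i)] at hxy
      obtain ⟨z, hz, hzy⟩ := ih hx hy' hxy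
      exact ⟨z, hz, by rw [wordMap_cons, hzy]⟩
    · have h₁ := h.sep i j hij _ (wordMap_mem h.map_mem w hx) y hy'
      have h₂ := mul_le_of_le_one_right h.δ_pos.le (h.wordRatio_le_one (i :: w))
      exact absurd (h₁.trans_lt (hxy.trans_le h₂)) (lt_irrefl _)

/-- The address of x is followed until one more letter would bring the ratio below ε. The number n
bounds the length of this search; the empty word covers an ε so large that it stops at once. -/
theorem exists_word_of_scale (h : IsSeparatedSelfSimilar ρ t δ E) {α β : ℝ} (hα : ∀ i, α ≤ ρ i)
    (hα1 : α ≤ 1) (hβ : ∀ i, ρ i ≤ β) (n : ℕ) :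
    ∀ {ε : ℝ}, β ^ n < ε → ∀ {x : ℝ}, x ∈ E →
      ∃ w, x ∈ wordMap ρ t w '' E ∧ (ε ≤ wordRatio ρ w ∨ w = []) ∧ α * wordRatio ρ w ≤ ε := by
  induction n with
  | zero =>
    intro ε hε x hx
    refine ⟨[], ⟨x, hx, rfl⟩, Or.inr rfl, ?_⟩
    rw [wordRatio_nil, mul_one]
    rw [pow_zero] at hε
    linarith
  | succ n ih =>
    intro ε hε x hx
    obtain ⟨i, y, hy, rfl⟩ := (h.mem_iff x).1 hx
    by_cases hi : ε ≤ ρ i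
    · have hβ0 : 0 < β := (h.pos i).trans_le (hβ i)
      have : β ^ n < ε / ρ i := by
        rw [lt_div_iff₀ (h.pos i)]
        refine lt_of_le_of_lt ?_ hε
        rw [pow_succ]
        exact mul_le_mul_of_nonneg_left (hβ i) (by positivity)
      obtain ⟨w, ⟨z, hz, hzy⟩, hw, hwε⟩ := ih this hy
      refine ⟨i :: w, ⟨z, hz, by rw [wordMap_cons, hzy]⟩, Or.inl ?_, ?_⟩
      · rw [wordRatio_cons]
        rcases hw with hw | rfl
        · rwa [div_le_iff₀' (h.pos i)] at hw
        · simpa using hi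
      · rw [le_div_iff₀' (h.pos i)] at hwε
        rw [wordRatio_cons]
        linarith
    · refine ⟨[], ⟨_, hx, rfl⟩, Or.inr rfl, ?_⟩
      rw [wordRatio_nil, mul_one]
      exact (hα i).trans (not_le.1 hi).le

/-- Every nonempty subset of `E` lies in a cylinder of comparable size. -/
theorem exists_cylinder (h : IsSeparatedSelfSimilar ρ t δ E) {α β : ℝ} (hα0 : 0 < α)
    (hα : ∀ i, α ≤ ρ i) (hα1 : α ≤ 1) (hβ1 : β < 1) (hβ : ∀ i, ρ i ≤ β)
    {K : Set ℝ} (hKE : K ⊆ E) (hK : K.Nonempty) {ε : ℝ} (hε : 0 < ε)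
    (hdiam : ∀ x ∈ K, ∀ y ∈ K, |x - y| ≤ ε) :
    ∃ w, K ⊆ wordMap ρ t w '' E ∧ wordRatio ρ w ≤ 2 / (δ * α) * ε := by
  obtain ⟨x, hx⟩ := hK
  have hδ := h.δ_pos
  -- The factor 2 turns the bound |x - y| ≤ ε into the strict inequality that keeps y in the
  -- cylinder of x.
  obtain ⟨n, hn⟩ := exists_pow_lt_of_lt_one (show 0 < 2 * ε / δ by positivity) hβ1
  obtain ⟨w, ⟨z, hz, rfl⟩, hw, hwε⟩ := h.exists_word_of_scale hα hα1 hβ n hn (hKE hx)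
  refine ⟨w, fun y hy => ?_, ?_⟩
  · rcases hw with hw | rfl
    · refine h.mem_cylinder_of_abs_sub_lt w hz (hKE hy) ?_
      rw [div_le_iff₀' hδ] at hw
      linarith [hdiam _ hx _ hy]
    · exact ⟨y, hKE hy, rfl⟩
  · rw [le_div_iff₀ hδ] at hwε
    rw [div_mul_eq_mul_div, le_div_iff₀ (by positivity)]
    linarith

variable {u : Fin k → ℝ} {μ : Set ℝ → ℝ}

/-- The preimages of K under all maps but the one named by the next letter miss `E`, so a single
term of the scaling identity survives at each letter. -/
theorem content_of_subset_cylinder (h : IsSeparatedSelfSimilar ρ t δ E)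
    (hμ0 : ∀ K, Disjoint K E → μ K = 0)
    (hμ : ∀ K, μ K = ∑ i, u i * μ ((fun x => ρ i * x + t i) ⁻¹' K)) (w : List (Fin k)) :
    ∀ {K : Set ℝ}, K ⊆ wordMap ρ t w '' E → μ K = wordRatio u w * μ (wordMap ρ t w ⁻¹' K) := by
  induction w with
  | nil => intro K _; rw [wordRatio_nil, one_mul]; rfl
  | cons i w ih =>
    intro K hK
    rw [hμ K, Finset.sum_eq_single i, ih, wordRatio_cons, mul_assoc]
    · rfl
    · intro y hy
      obtain ⟨z, hz, hzy⟩ := hK hy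
      rw [wordMap_cons] at hzy
      exact ⟨z, hz, mul_left_cancel₀ (h.pos i).ne' (add_right_cancel hzy)⟩
    · intro j _ hj
      rw [hμ0, mul_zero]
      refine Set.disjoint_left.2 fun y hy hyE => ?_
      obtain ⟨z, hz, hzy⟩ := hK hy
      rw [wordMap_cons] at hzy
      have h₁ := h.sep i j hj.symm _ (wordMap_mem h.map_mem w hz) y hyE
      rw [hzy, sub_self, abs_zero] at h₁
      exact absurd h.δ_pos (not_lt.2 h₁)
    · exact fun hi => absurd (Finset.mem_univ i) hi

/-- The hypothesis says that K contains each level-D cylinder of `E` or misses it. Unfolding the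
scaling identity D times leaves only contents 0 and 1, so finitely many values are possible. -/
theorem content_mem_contentValues (hμ0 : ∀ K, Disjoint K E → μ K = 0)
    (hμ1 : ∀ K, E ⊆ K → μ K = 1)
    (hμ : ∀ K, μ K = ∑ i, u i * μ ((fun x => ρ i * x + t i) ⁻¹' K)) (D : ℕ) :
    ∀ {K : Set ℝ}, (∀ w : List (Fin k), w.length = D → ∀ x ∈ E, ∀ y ∈ E,
      wordMap ρ t w x ∈ K → wordMap ρ t w y ∈ K) → μ K ∈ contentValues u D := by
  induction D with
  | zero =>
    intro K hK
    by_cases hd : Disjoint K E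
    · exact Or.inl (hμ0 K hd)
    · obtain ⟨x, hx, hxE⟩ := Set.not_disjoint_iff.1 hd
      exact Or.inr (hμ1 K fun y hy => hK [] rfl x hxE y hy hx)
  | succ D ih =>
    intro K hK
    rw [hμ K]
    exact ⟨_, fun i => ih fun w hw x hx y hy hxK =>
      hK (i :: w) (by rw [List.length_cons, hw]) x hx y hy hxK, rfl⟩

end IsSeparatedSelfSimilar

/-! ### Almost extremal cylinders -/

/-- On small cylinders, a subadditive function of words that is almost extremal with respect to the
weights `u` is almost proportional to `u`. -/
theorem exists_almost_proportional {u : Fin 3 → ℝ} (hu : ∀ i, 0 < u i) (hsum : ∑ i, u i = 1)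
    (ν νJ : List (Fin 3) → ℝ) (hν0 : 0 < ν []) {C : ℝ} (hC : ∀ v, ν v ≤ C * wordRatio u v)
    (hν : ∀ v, ν v ≤ ∑ i, ν (v ++ [i])) (hJ : ∀ v, ν v ≤ ν (v ++ [0]) + νJ v)
    (hJ' : ∀ v, νJ v ≤ ν (v ++ [1]) + ν (v ++ [2])) :
    ∃ L > 0, ∀ ε > 0, ∃ v, ∀ w,
      |νJ (v ++ w) - L * wordRatio u v * wordRatio u w| ≤ ε * wordRatio u v := by
  have hpos := wordRatio_pos hu
  have hbdd : BddAbove (Set.range fun v => ν v / wordRatio u v) :=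
    ⟨C, by rintro _ ⟨v, rfl⟩; exact (div_le_iff₀ (hpos v)).2 (hC v)⟩
  -- Λ is the supremum of ν / u over all words.
  obtain ⟨Λ, hΛ, hΛ'⟩ : ∃ Λ, (∀ v, ν v ≤ Λ * wordRatio u v) ∧
      ∀ ε > 0, ∃ v, (Λ - ε) * wordRatio u v < ν v := by
    refine ⟨⨆ v, ν v / wordRatio u v, fun v => ?_, fun ε hε => ?_⟩
    · exact (div_le_iff₀ (hpos v)).1 (le_ciSup hbdd v)
    · obtain ⟨v, hv⟩ := exists_lt_of_lt_ciSup
        (show (⨆ v, ν v / wordRatio u v) - ε < ⨆ v, ν v / wordRatio u v by linarith)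
      exact ⟨v, (lt_div_iff₀ (hpos v)).1 hv⟩
  have hΛ0 : 0 < Λ := by
    have := hΛ []
    rw [wordRatio_nil, mul_one] at this
    linarith
  -- The defects Λ u - ν are nonnegative, and by subadditivity those of the children sum to at most
  -- that of the parent; so a defect never grows along a word.
  have hstep : ∀ v i, Λ * wordRatio u (v ++ [i]) - ν (v ++ [i]) ≤ Λ * wordRatio u v - ν v := by
    intro v i
    calc Λ * wordRatio u (v ++ [i]) - ν (v ++ [i])
        ≤ ∑ j, (Λ * wordRatio u (v ++ [j]) - ν (v ++ [j])) :=
          Finset.single_le_sum (f := fun j => Λ * wordRatio u (v ++ [j]) - ν (v ++ [j]))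
            (fun j _ => sub_nonneg.2 (hΛ _)) (Finset.mem_univ i)
      _ = Λ * wordRatio u v * ∑ j, u j - ∑ j, ν (v ++ [j]) := by
          rw [Finset.sum_sub_distrib, Finset.mul_sum]
          simp only [wordRatio_append, wordRatio_cons, wordRatio_nil, mul_one, mul_assoc]
      _ ≤ _ := by rw [hsum, mul_one]; linarith [hν v]
  have hdefect : ∀ w v, Λ * wordRatio u (v ++ w) - ν (v ++ w) ≤ Λ * wordRatio u v - ν v := by
    intro w
    induction w with
    | nil => intro v; simp
    | cons i w ih =>
      intro v
      have := ih (v ++ [i])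
      rw [List.append_assoc, List.singleton_append] at this
      exact this.trans (hstep v i)
  refine ⟨Λ * (u 1 + u 2), mul_pos hΛ0 (add_pos (hu 1) (hu 2)), fun ε hε => ?_⟩
  obtain ⟨v, hv⟩ := hΛ' ε hε
  refine ⟨v, fun w => ?_⟩
  have h₁ := hdefect w v
  have h₂ := hJ (v ++ w)
  have h₃ := hJ' (v ++ w)
  have h₄ := hΛ ((v ++ w) ++ [0])
  have h₅ := hΛ ((v ++ w) ++ [1])
  have h₆ := hΛ ((v ++ w) ++ [2])
  have h₇ : u 0 + u 1 + u 2 = 1 := by rw [← hsum, Fin.sum_univ_three]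
  simp only [wordRatio_append, wordRatio_cons, wordRatio_nil, mul_one] at h₁ h₄ h₅ h₆
  have h₈ : 0 ≤ ε * wordRatio u v := mul_nonneg hε.le (hpos v).le
  have h₉ : Λ * (wordRatio u v * wordRatio u w) = Λ * (wordRatio u v * wordRatio u w * u 0) +
      Λ * (wordRatio u v * wordRatio u w * u 1) + Λ * (wordRatio u v * wordRatio u w * u 2) := by
    linear_combination -(Λ * (wordRatio u v * wordRatio u w)) * h₇
  rw [abs_le]
  constructor <;> nlinarith

theorem exists_wordMap_eq {k : ℕ} {ρ t : Fin k → ℝ} (hρ : ∀ i, 0 < ρ i) (w : List (Fin k))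
    (x : ℝ) : ∃ y, wordMap ρ t w y = x := by
  have hw := wordRatio_pos hρ w
  refine ⟨(x - wordMap ρ t w 0) / wordRatio ρ w, ?_⟩
  have := wordMap_sub (ρ := ρ) (t := t) w ((x - wordMap ρ t w 0) / wordRatio ρ w) 0
  rw [sub_zero, mul_div_cancel₀ _ hw.ne'] at this
  linarith

/-! ### Cylinders of ternary sets -/

namespace IsTernarySet

variable {ρ : Fin 3 → ℝ} {d : ℝ} {E : Set ℝ}

theorem ratio_pos (h : IsTernarySet (ρ 0) (ρ 1) (ρ 2) d E) (i : Fin 3) : 0 < ρ i := by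
  fin_cases i
  exacts [h.a_pos, h.b_pos, h.c_pos]

theorem ratio_lt_one (h : IsTernarySet (ρ 0) (ρ 1) (ρ 2) d E) (i : Fin 3) : ρ i < 1 := by
  fin_cases i
  exacts [h.a_lt_one, h.b_lt_one, h.c_lt_one]

theorem mem_iff_exists (h : IsTernarySet (ρ 0) (ρ 1) (ρ 2) d E) (x : ℝ) :
    x ∈ E ↔ ∃ i, ∃ y ∈ E, ρ i * y + ![0, d, 1 - ρ 2] i = x := by
  rw [h.mem_iff]
  constructor
  · rintro (⟨y, hy, rfl⟩ | ⟨y, hy, rfl⟩ | ⟨y, hy, rfl⟩)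
    · exact ⟨0, y, hy, by simp⟩
    · exact ⟨1, y, hy, by simp⟩
    · exact ⟨2, y, hy, by simp⟩
  · rintro ⟨i, y, hy, rfl⟩
    fin_cases i
    · exact Or.inl ⟨y, hy, by simp⟩
    · exact Or.inr (Or.inl ⟨y, hy, by simp⟩)
    · exact Or.inr (Or.inr ⟨y, hy, by simp⟩)

theorem map_mem (h : IsTernarySet (ρ 0) (ρ 1) (ρ 2) d E) (i : Fin 3) (x : ℝ) (hx : x ∈ E) :
    ρ i * x + ![0, d, 1 - ρ 2] i ∈ E := (h.mem_iff_exists _).2 ⟨i, x, hx, rfl⟩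

theorem isSeparatedSelfSimilar (h : IsTernarySet (ρ 0) (ρ 1) (ρ 2) d E)
    (hd : d < 1 - ρ 1 - ρ 2) :
    IsSeparatedSelfSimilar ρ ![0, d, 1 - ρ 2] (min (d - ρ 0) (1 - ρ 1 - ρ 2 - d)) E where
  pos := h.ratio_pos
  lt_one := h.ratio_lt_one
  δ_pos := lt_min (sub_pos.2 h.a_lt) (sub_pos.2 hd)
  mem_iff := h.mem_iff_exists
  sep i j hij x hx y hy := by
    have h0 := h.a_pos
    have h1 := h.b_pos
    have h2 := h.c_pos
    have hx' := h.subset_Icc hx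
    have hy' := h.subset_Icc hy
    have key : ∀ x ∈ Set.Icc (0 : ℝ) 1, ∀ r : ℝ, 0 < r → 0 ≤ r * x ∧ r * x ≤ r :=
      fun x hx r hr => ⟨mul_nonneg hr.le hx.1, mul_le_of_le_one_right hr.le hx.2⟩
    have a0 := key x hx' _ h0
    have a1 := key x hx' _ h1
    have a2 := key x hx' _ h2
    have b0 := key y hy' _ h0
    have b1 := key y hy' _ h1
    have b2 := key y hy' _ h2
    have m₁ := min_le_left (d - ρ 0) (1 - ρ 1 - ρ 2 - d)
    have m₂ := min_le_right (d - ρ 0) (1 - ρ 1 - ρ 2 - d)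
    fin_cases i <;> fin_cases j <;> first | exact absurd rfl hij | skip
    all_goals simp only [Fin.zero_eta, Fin.mk_one, Fin.reduceFinMk, Matrix.cons_val]
    all_goals rw [le_abs]
    · right; linarith
    · right; linarith
    · left; linarith
    · right; linarith
    · left; linarith
    · left; linarith

/-- When two pieces touch, a point of one piece's interval may come from the other piece. This
happens only at a common endpoint, whose preimage is 0 or 1 and thus in `E` anyway. -/
theorem mem_of_map_mem (h : IsTernarySet (ρ 0) (ρ 1) (ρ 2) d E) (i : Fin 3) {q : ℝ}
    (hq : q ∈ Set.Icc (0 : ℝ) 1) (hqE : ρ i * q + ![0, d, 1 - ρ 2] i ∈ E) : q ∈ E := by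
  have h0 := h.a_pos
  have h1 := h.b_pos
  have h2 := h.c_pos
  have hd := h.d_le
  have hda := h.a_lt
  obtain ⟨j, y, hy, hyq⟩ := (h.mem_iff_exists _).1 hqE
  by_cases hij : j = i
  · subst hij
    rwa [← mul_left_cancel₀ (h.ratio_pos j).ne' (add_right_cancel hyq)]
  have hy' := h.subset_Icc hy
  have key : ∀ x ∈ Set.Icc (0 : ℝ) 1, ∀ r : ℝ, 0 < r → 0 ≤ r * x ∧ r * x ≤ r :=
    fun x hx r hr => ⟨mul_nonneg hr.le hx.1, mul_le_of_le_one_right hr.le hx.2⟩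
  have a0 := key q hq _ h0
  have a1 := key q hq _ h1
  have a2 := key q hq _ h2
  have b0 := key y hy' _ h0
  have b1 := key y hy' _ h1
  have b2 := key y hy' _ h2
  fin_cases i <;> fin_cases j <;> first | exact absurd rfl hij | skip
  all_goals simp only [Fin.zero_eta, Fin.mk_one, Fin.reduceFinMk, Matrix.cons_val] at hyq
  · linarith
  · linarith
  · linarith
  · have : q = 1 := le_antisymm hq.2 (le_of_mul_le_mul_left (by linarith) h1)
    rw [this]; exact h.one_mem
  · linarith
  · have : q = 0 := le_antisymm (le_of_mul_le_mul_left (by linarith) h2) hq.1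
    rw [this]; exact h.zero_mem

theorem mem_of_wordMap_mem (h : IsTernarySet (ρ 0) (ρ 1) (ρ 2) d E) (w : List (Fin 3)) {q : ℝ}
    (hq : q ∈ Set.Icc (0 : ℝ) 1) (hqE : wordMap ρ ![0, d, 1 - ρ 2] w q ∈ E) : q ∈ E := by
  induction w with
  | nil => exact hqE
  | cons i w ih =>
    refine ih (h.mem_of_map_mem i ?_ hqE)
    refine wordMap_mem (E := Set.Icc (0 : ℝ) 1) (fun j x hx => ?_) w hq
    have h0 := h.a_pos
    have h1 := h.b_pos
    have h2 := h.c_pos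
    have hd := h.d_le
    have hda := h.a_lt
    have h2' := h.c_lt_one
    have key : ∀ r : ℝ, 0 < r → 0 ≤ r * x ∧ r * x ≤ r :=
      fun r hr => ⟨mul_nonneg hr.le hx.1, mul_le_of_le_one_right hr.le hx.2⟩
    have a0 := key _ h0
    have a1 := key _ h1
    have a2 := key _ h2
    fin_cases j
    all_goals simp only [Fin.zero_eta, Fin.mk_one, Fin.reduceFinMk, Matrix.cons_val]
    all_goals constructor <;> linarith

/-- The second and third pieces of a first piece are isolated. -/
theorem mem_image_of_abs_sub_lt (h : IsTernarySet (ρ 0) (ρ 1) (ρ 2) d E) (w : List (Fin 3))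
    {q x : ℝ} (hq : q ∈ E ∩ Set.Ici d) (hx : x ∈ E)
    (hqx : |wordMap ρ ![0, d, 1 - ρ 2] (w ++ [0]) q - x| <
      (d - ρ 0) * wordRatio ρ (w ++ [0])) :
    x ∈ wordMap ρ ![0, d, 1 - ρ 2] (w ++ [0]) '' (E ∩ Set.Ici d) := by
  have h0 := h.a_pos
  have h0' := h.a_lt_one
  have hda := h.a_lt
  have hd1 := h.d_lt_one
  have hw := wordRatio_pos h.ratio_pos w
  obtain ⟨p, rfl⟩ := exists_wordMap_eq (t := ![0, d, 1 - ρ 2]) h.ratio_pos w x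
  have hq1 := (h.subset_Icc hq.1).2
  have hqd : d ≤ q := hq.2
  rw [wordMap_append, abs_wordMap_sub h.ratio_pos, wordRatio_append, mul_left_comm,
    mul_lt_mul_iff_right₀ hw] at hqx
  simp only [wordMap_cons, wordMap_nil, Matrix.cons_val_zero, add_zero, wordRatio_cons,
    wordRatio_nil, mul_one] at hqx
  obtain ⟨hl, hr⟩ := abs_lt.1 hqx
  have e₁ : ρ 0 * d ≤ ρ 0 * q := mul_le_mul_of_nonneg_left hqd h0.le
  have e₂ : ρ 0 * q ≤ ρ 0 := mul_le_of_le_one_right h0.le hq1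
  have e₃ : (d - ρ 0) * ρ 0 ≤ d - ρ 0 := mul_le_of_le_one_right (sub_nonneg.2 hda.le) h0'.le
  have e₄ : 0 < ρ 0 * ρ 0 := mul_pos h0 h0
  -- In the coordinates of the cylinder w, the point lies strictly between ρ 0 * ρ 0 and d. The only
  -- part of `E` there is the image of `E ∩ Set.Ici d` under the first map.
  have hpd : p < d := by linarith
  have hp0 : ρ 0 * ρ 0 < p := by linarith
  have hpE : p ∈ E := h.mem_of_wordMap_mem w ⟨by linarith, by linarith⟩ hx
  obtain ⟨i, y, hy, hyp⟩ := (h.mem_iff_exists p).1 hpE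
  have hy' := h.subset_Icc hy
  have hi : i = 0 := by
    have b1 := mul_nonneg h.b_pos.le hy'.1
    have b2 := mul_nonneg h.c_pos.le hy'.1
    have := h.d_le
    have := h.b_pos
    fin_cases i
    · rfl
    all_goals simp only [Fin.mk_one, Fin.reduceFinMk, Matrix.cons_val] at hyp; linarith
  subst hi
  simp only [Matrix.cons_val_zero, add_zero] at hyp
  refine ⟨y, ⟨hy, ?_⟩, by simp [wordMap_append, hyp]⟩
  have hy0 : ρ 0 < y := by
    rw [← hyp] at hp0
    exact lt_of_mul_lt_mul_left hp0 h0.le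
  obtain ⟨i, z, hz, hzy⟩ := (h.mem_iff_exists y).1 hy
  have hz' := h.subset_Icc hz
  have b0 := mul_le_of_le_one_right h0.le hz'.2
  have b1 := mul_nonneg h.b_pos.le hz'.1
  have b2 := mul_nonneg h.c_pos.le hz'.1
  have := h.d_le
  have := h.b_pos
  rw [Set.mem_Ici]
  fin_cases i
  all_goals
    simp only [Fin.zero_eta, Fin.mk_one, Fin.reduceFinMk, Matrix.cons_val] at hzy; linarith

theorem inter_Ici_eq (h : IsTernarySet (ρ 0) (ρ 1) (ρ 2) d E) :
    E ∩ Set.Ici d = wordMap ρ ![0, d, 1 - ρ 2] [1] '' E ∪ wordMap ρ ![0, d, 1 - ρ 2] [2] '' E := by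
  have := h.d_le
  have hb := h.b_pos
  ext x
  constructor
  · rintro ⟨hx, hxd⟩
    obtain ⟨i, y, hy, rfl⟩ := (h.mem_iff_exists x).1 hx
    fin_cases i
    · have b0 := mul_le_of_le_one_right h.a_pos.le (h.subset_Icc hy).2
      have := h.a_lt
      rw [Set.mem_Ici] at hxd
      simp only [Fin.zero_eta, Matrix.cons_val] at hxd
      linarith
    · exact Or.inl ⟨y, hy, rfl⟩
    · exact Or.inr ⟨y, hy, rfl⟩
  · rintro (⟨y, hy, rfl⟩ | ⟨y, hy, rfl⟩)
    · refine ⟨h.map_mem 1 y hy, ?_⟩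
      have b1 := mul_nonneg h.b_pos.le (h.subset_Icc hy).1
      simp only [wordMap_cons, wordMap_nil, Matrix.cons_val, Set.mem_Ici]
      linarith
    · refine ⟨h.map_mem 2 y hy, ?_⟩
      have b2 := mul_nonneg h.c_pos.le (h.subset_Icc hy).1
      simp only [wordMap_cons, wordMap_nil, Matrix.cons_val, Set.mem_Ici]
      linarith

theorem eq_union_inter_Ici (h : IsTernarySet (ρ 0) (ρ 1) (ρ 2) d E) :
    E = wordMap ρ ![0, d, 1 - ρ 2] [0] '' E ∪ E ∩ Set.Ici d := by
  rw [h.inter_Ici_eq]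
  ext x
  rw [h.mem_iff_exists]
  simp [Fin.exists_fin_succ]

end IsTernarySet

/-! ### Necessity -/

/-- The points of the domain, as a subset of the ambient space, that `f` maps into `B`. -/
def pullback {M M' : Set ℝ} (f : M ≃ M') (B : Set ℝ) : Set ℝ :=
  Subtype.val '' ((fun x => (f x : ℝ)) ⁻¹' B)

theorem pullback_union {M M' : Set ℝ} (f : M ≃ M') (B B' : Set ℝ) :
    pullback f (B ∪ B') = pullback f B ∪ pullback f B' := by
  rw [pullback, Set.preimage_union, Set.image_union]; rfl

theorem pullback_subset {M M' : Set ℝ} (f : M ≃ M') (B : Set ℝ) : pullback f B ⊆ M := by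
  rintro _ ⟨x, _, rfl⟩; exact x.2

theorem pullback_nonempty {M M' : Set ℝ} (f : M ≃ M') {B : Set ℝ} {y : ℝ} (hy : y ∈ M')
    (hyB : y ∈ B) : (pullback f B).Nonempty :=
  ⟨_, f.symm ⟨y, hy⟩, by simpa using hyB, rfl⟩

/-- The sum is 3 at s = 0 and less than 1 at s = 1. With this s the weights ρ^s sum to 1 and are
comparable with the s-th power of the diameter. -/
theorem exists_sum_rpow_eq_one {ρ : Fin 3 → ℝ} (hρ : ∀ i, 0 < ρ i) (hsum : ∑ i, ρ i < 1) :
    ∃ s : ℝ, 0 ≤ s ∧ ∑ i, ρ i ^ s = 1 := by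
  have hcont : ContinuousOn (fun s : ℝ => ∑ i, ρ i ^ s) (Set.Icc 0 1) :=
    continuousOn_finsetSum _ fun i _ => (Real.continuous_const_rpow (hρ i).ne').continuousOn
  obtain ⟨s, hs, hs1⟩ := intermediate_value_Icc' (zero_le_one' ℝ) hcont
    (show (1 : ℝ) ∈ _ by simp only [Real.rpow_one, Real.rpow_zero]; simp [hsum.le])
  exact ⟨s, hs.1, hs1⟩

section Necessity

variable {ρ : Fin 3 → ℝ} {d d' : ℝ} {M M' : Set ℝ}

/-- The cylinder 1 2^k ends at the touching point 1 - ρ 2 and the cylinder 2 0^m begins there. The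
final letter 0 selects their first subcopies, whose upper parts are isolated. -/
theorem abs_wordMap_sub_touching_point (h' : IsTernarySet (ρ 0) (ρ 1) (ρ 2) (1 - ρ 1 - ρ 2) M')
    {k m : ℕ} (hkm : ρ 0 ^ (m + 1) < ρ 2 ^ k) {q : ℝ} (hq : q ∈ Set.Icc (0 : ℝ) 1)
    {w : List (Fin 3)}
    (hw : w = 1 :: List.replicate k 2 ++ [0] ∨ w = 2 :: List.replicate m 0 ++ [0]) :
    |wordMap ρ ![0, 1 - ρ 1 - ρ 2, 1 - ρ 2] w q - (1 - ρ 2)| ≤ ρ 2 ^ k := by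
  have h0 := h'.a_pos
  have h1 := h'.b_pos
  have h2 := h'.c_pos
  have hq' : 0 ≤ ρ 0 * q := mul_nonneg h0.le hq.1
  have hq'' : ρ 0 * q ≤ ρ 0 := mul_le_of_le_one_right h0.le hq.2
  have hfix : ∀ (n : ℕ) (i : Fin 3) (x : ℝ),
      ρ i * x + ![0, 1 - ρ 1 - ρ 2, 1 - ρ 2] i = x →
      wordMap ρ ![0, 1 - ρ 1 - ρ 2, 1 - ρ 2] (List.replicate n i) x = x := by
    intro n i x hx
    induction n with
    | zero => rfl
    | succ n ih => rw [List.replicate_succ, wordMap_cons, ih, hx]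
  have hsub : ∀ (v : List (Fin 3)) (x y : ℝ),
      wordMap ρ ![0, 1 - ρ 1 - ρ 2, 1 - ρ 2] v x = 1 - ρ 2 →
      |wordMap ρ ![0, 1 - ρ 1 - ρ 2, 1 - ρ 2] v y - (1 - ρ 2)| = wordRatio ρ v * |y - x| := by
    intro v x y hx
    have := abs_wordMap_sub (t := ![0, 1 - ρ 1 - ρ 2, 1 - ρ 2]) h'.ratio_pos v y x
    rwa [hx] at this
  have hlast : wordMap ρ ![0, 1 - ρ 1 - ρ 2, 1 - ρ 2] [0] q = ρ 0 * q := by simp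
  rcases hw with rfl | rfl
  · rw [wordMap_append, hlast, hsub _ 1, wordRatio_cons, wordRatio_replicate]
    · have e₁ : |ρ 0 * q - 1| ≤ 1 := by
        rw [abs_le]; constructor <;> linarith [h'.a_lt_one]
      have e₂ : ρ 1 * ρ 2 ^ k ≤ ρ 2 ^ k := mul_le_of_le_one_left (by positivity) h'.b_lt_one.le
      calc _ ≤ ρ 1 * ρ 2 ^ k * 1 := by gcongr
        _ ≤ _ := by linarith
    · rw [wordMap_cons, hfix k 2 1 (by simp)]
      simp only [Matrix.cons_val]
      ring
  · rw [wordMap_append, hlast, hsub _ 0, wordRatio_cons, wordRatio_replicate]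
    · rw [sub_zero, abs_of_nonneg hq']
      have e₂ : ρ 2 * ρ 0 ^ m ≤ ρ 0 ^ m := mul_le_of_le_one_left (by positivity) h'.c_lt_one.le
      calc _ ≤ ρ 0 ^ m * ρ 0 := by gcongr
        _ ≤ _ := by rw [← pow_succ]; exact hkm.le
    · rw [wordMap_cons, hfix m 0 0 (by simp)]
      simp

/-- A bi-Lipschitz bijection forces the weights of comparable pieces on the two sides of a touching
point to have only finitely many ratios. -/
theorem exists_finite_ratios {δ : ℝ} (h : IsTernarySet (ρ 0) (ρ 1) (ρ 2) d M)
    (hM : IsSeparatedSelfSimilar ρ ![0, d, 1 - ρ 2] δ M)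
    (h' : IsTernarySet (ρ 0) (ρ 1) (ρ 2) (1 - ρ 1 - ρ 2) M')
    (f : M ≃ M') {c c' : ℝ} (hc : 0 < c) (hc' : 0 < c')
    (hf : ∀ x y : M, c * dist x y ≤ dist (f x) (f y) ∧ dist (f x) (f y) ≤ c' * dist x y)
    {s : ℝ} (hs : 0 ≤ s) (hsum : ∑ i, ρ i ^ s = 1) :
    ∃ Q : Set ℝ, Q.Finite ∧ ∀ k m : ℕ, ρ 0 ^ (m + 1) < ρ 2 ^ k → ρ 2 ^ k ≤ ρ 0 ^ m →
      wordRatio (fun i => ρ i ^ s) (1 :: List.replicate k 2 ++ [0]) /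
        wordRatio (fun i => ρ i ^ s) (2 :: List.replicate m 0 ++ [0]) ∈ Q := by
  set t : Fin 3 → ℝ := ![0, d, 1 - ρ 2] with ht
  set t' : Fin 3 → ℝ := ![0, 1 - ρ 1 - ρ 2, 1 - ρ 2] with ht'
  set u : Fin 3 → ℝ := fun i => ρ i ^ s with hu
  have h0 := h.a_pos
  have h1 := h.b_pos
  have h2 := h.c_pos
  have hδ := hM.δ_pos
  have hupos : ∀ i, 0 < u i := fun i => Real.rpow_pos_of_pos (hM.pos i) s
  have hρw := wordRatio_pos hM.pos
  obtain ⟨μ, hμle, hμadd, hμ0, hμ1, hμ⟩ := exists_selfSimilar_content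
    (φ := fun i x => ρ i * x + t i) (u := u) ⟨0, h.zero_mem⟩ (fun i x hx => hM.map_mem i x hx)
    (fun i => (hupos i).le) hsum
  -- uniform bounds for the ratios
  obtain ⟨α, hα0, hα, hα1⟩ : ∃ α > 0, (∀ i, α ≤ ρ i) ∧ α ≤ 1 := by
    refine ⟨min (ρ 0) (min (ρ 1) (ρ 2)), lt_min h0 (lt_min h1 h2), fun i => ?_,
      (min_le_left _ _).trans h.a_lt_one.le⟩
    fin_cases i <;> simp
  obtain ⟨β, hβ0, hβ1, hβ⟩ : ∃ β ≥ 0, β < 1 ∧ ∀ i, ρ i ≤ β := by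
    refine ⟨max (ρ 0) (max (ρ 1) (ρ 2)), h0.le.trans (le_max_left _ _),
      max_lt h.a_lt_one (max_lt h.b_lt_one h.c_lt_one), fun i => ?_⟩
    fin_cases i <;> simp
  have hloc : ∀ {K : Set ℝ} {ε : ℝ}, K ⊆ M → K.Nonempty → 0 < ε →
      (∀ x ∈ K, ∀ y ∈ K, |x - y| ≤ ε) →
      ∃ w, K ⊆ wordMap ρ t w '' M ∧ wordRatio ρ w ≤ 2 / (δ * α) * ε := fun hK hne hε hd =>
    hM.exists_cylinder hα0 hα hα1 hβ1 hβ hK hne hε hd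
  have hfd : ∀ x y : M, |(x : ℝ) - y| ≤ |(f x : ℝ) - f y| / c := fun x y => by
    rw [le_div_iff₀' hc]; exact (hf x y).1
  -- the two set functions
  let ν : List (Fin 3) → ℝ := fun v => μ (pullback f (wordMap ρ t' v '' M'))
  let νJ : List (Fin 3) → ℝ := fun v =>
    μ (pullback f (wordMap ρ t' v '' (M' ∩ Set.Ici (1 - ρ 1 - ρ 2))))
  have himage : ∀ (v w : List (Fin 3)) (A : Set ℝ),
      wordMap ρ t' v '' (wordMap ρ t' w '' A) = wordMap ρ t' (v ++ w) '' A := by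
    intro v w A
    rw [Set.image_image]
    exact Set.image_congr fun x _ => (wordMap_append _ _ _ _ _).symm
  have hJ : ∀ v, ν v ≤ ν (v ++ [0]) + νJ v := by
    intro v
    have : wordMap ρ t' v '' M' = wordMap ρ t' (v ++ [0]) '' M' ∪
        wordMap ρ t' v '' (M' ∩ Set.Ici (1 - ρ 1 - ρ 2)) := by
      rw [← himage, ← Set.image_union, ← h'.eq_union_inter_Ici]
    change μ (pullback f (wordMap ρ t' v '' M')) ≤ _
    rw [this, pullback_union]
    exact hμadd _ _
  have hJ' : ∀ v, νJ v ≤ ν (v ++ [1]) + ν (v ++ [2]) := by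
    intro v
    change μ (pullback f (wordMap ρ t' v '' (M' ∩ Set.Ici (1 - ρ 1 - ρ 2)))) ≤ _
    rw [h'.inter_Ici_eq, Set.image_union, himage, himage, pullback_union]
    exact hμadd _ _
  have hν0 : 0 < ν [] := by
    have : μ (pullback f (wordMap ρ t' [] '' M')) = 1 := by
      refine hμ1 _ fun x hx => ⟨⟨x, hx⟩, ⟨_, (f ⟨x, hx⟩).2, rfl⟩, rfl⟩
    change 0 < μ (pullback f (wordMap ρ t' [] '' M'))
    rw [this]; exact one_pos
  have hcyl : ∀ {K : Set ℝ} {w : List (Fin 3)}, K ⊆ wordMap ρ t w '' M →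
      μ K = wordRatio u w * μ (wordMap ρ t w ⁻¹' K) := fun hK =>
    hM.content_of_subset_cylinder hμ0 hμ _ hK
  -- The preimage of a cylinder has comparable diameter, so it lies in a comparable cylinder of `M`;
  -- raising ratios to the power s gives weights.
  have hC : ∀ v, ν v ≤ (2 / (δ * α) * (1 / c)) ^ s * wordRatio u v := by
    intro v
    have hd : ∀ x ∈ pullback f (wordMap ρ t' v '' M'), ∀ y ∈ pullback f (wordMap ρ t' v '' M'),
        |x - y| ≤ wordRatio ρ v / c := by
      rintro _ ⟨x, ⟨p, hp, hpx⟩, rfl⟩ _ ⟨y, ⟨q, hq, hqy⟩, rfl⟩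
      refine (hfd x y).trans ?_
      dsimp only at hpx hqy
      rw [← hpx, ← hqy, abs_wordMap_sub hM.pos]
      have h₁ := Real.dist_le_of_mem_Icc_01 (h'.subset_Icc hp) (h'.subset_Icc hq)
      rw [Real.dist_eq] at h₁
      have := (hρw v).le
      gcongr
      exact mul_le_of_le_one_right this h₁
    obtain ⟨w, hKw, hw⟩ := hloc (pullback_subset _ _) (pullback_nonempty f
      (wordMap_mem h'.map_mem v h'.zero_mem)
      (Set.mem_image_of_mem _ h'.zero_mem)) (div_pos (hρw v) hc) hd
    change μ (pullback f (wordMap ρ t' v '' M')) ≤ _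
    rw [hcyl hKw, wordRatio_rpow hM.pos, wordRatio_rpow hM.pos,
      ← Real.mul_rpow (by positivity) (hρw v).le]
    refine (mul_le_of_le_one_right (Real.rpow_nonneg (hρw w).le s) (hμle _)).trans ?_
    refine Real.rpow_le_rpow (hρw w).le (hw.trans (le_of_eq ?_)) hs
    ring
  obtain ⟨L, hL, hprop⟩ := exists_almost_proportional hupos hsum ν νJ hν0 hC
    (fun v => by rw [Fin.sum_univ_three]; linarith [hJ v, hJ' v]) hJ hJ'
  -- the level of the pattern
  set g : ℝ := (1 - ρ 1 - ρ 2 - ρ 0) * (ρ 0 * ρ 1 * ρ 2) with hg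
  have hg0 : 0 < g := mul_pos (sub_pos.2 h'.a_lt) (by positivity)
  -- D is so large that f maps a level-D subcylinder of the common cylinder to a set shorter than
  -- the gaps isolating the two pieces. It depends on none of v, k and m.
  obtain ⟨D, hD⟩ := exists_pow_lt_of_lt_one
    (show 0 < g / (c' * (2 / (δ * α) * (2 / c))) by positivity) hβ1
  rw [lt_div_iff₀ (by positivity)] at hD
  have hfin := finite_contentValues u D
  refine ⟨Set.image2 (· / ·) (contentValues u D) (contentValues u D), hfin.image2 _ hfin,
    fun k m hkm hkm' => ?_⟩
  set wa : List (Fin 3) := 1 :: List.replicate k 2 ++ [0] with hwa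
  set wb : List (Fin 3) := 2 :: List.replicate m 0 ++ [0] with hwb
  have hk0 : 0 < ρ 2 ^ k := pow_pos h2 k
  have hra : ρ 0 * ρ 1 * ρ 2 * ρ 2 ^ k ≤ wordRatio ρ wa := by
    rw [hwa, wordRatio_append, wordRatio_cons, wordRatio_replicate, wordRatio_cons,
      wordRatio_nil]
    calc ρ 0 * ρ 1 * ρ 2 * ρ 2 ^ k = ρ 0 * ρ 1 * ρ 2 ^ k * ρ 2 := by ring
      _ ≤ ρ 0 * ρ 1 * ρ 2 ^ k := mul_le_of_le_one_right (by positivity) h.c_lt_one.le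
      _ = _ := by ring
  have hrb : ρ 0 * ρ 1 * ρ 2 * ρ 2 ^ k ≤ wordRatio ρ wb := by
    rw [hwb, wordRatio_append, wordRatio_cons, wordRatio_replicate, wordRatio_cons,
      wordRatio_nil]
    calc ρ 0 * ρ 1 * ρ 2 * ρ 2 ^ k ≤ ρ 0 * ρ 1 * ρ 2 * ρ 0 ^ m := by gcongr
      _ = ρ 0 * ρ 2 * ρ 0 ^ m * ρ 1 := by ring
      _ ≤ ρ 0 * ρ 2 * ρ 0 ^ m := mul_le_of_le_one_right (by positivity) h.b_lt_one.le
      _ = _ := by ring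
  -- both pieces are unions of cylinders of bounded relative level
  have hpattern : ∀ v, ∃ W : ℝ, 0 < W ∧ ∃ x ∈ contentValues u D, ∃ y ∈ contentValues u D,
      νJ (v ++ wa) = W * x ∧ νJ (v ++ wb) = W * y := by
    intro v
    set Ka := pullback f (wordMap ρ t' (v ++ wa) '' (M' ∩ Set.Ici (1 - ρ 1 - ρ 2)))
    set Kb := pullback f (wordMap ρ t' (v ++ wb) '' (M' ∩ Set.Ici (1 - ρ 1 - ρ 2)))
    have hr0 : 0 < wordRatio ρ v * ρ 2 ^ k := mul_pos (hρw v) hk0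
    have hnear : ∀ x : M, (x : ℝ) ∈ Ka ∪ Kb →
        |(f x : ℝ) - wordMap ρ t' v (1 - ρ 2)| ≤ wordRatio ρ v * ρ 2 ^ k := by
      have key : ∀ w, (w = wa ∨ w = wb) → ∀ x : M,
          (x : ℝ) ∈ pullback f (wordMap ρ t' (v ++ w) '' (M' ∩ Set.Ici (1 - ρ 1 - ρ 2))) →
          |(f x : ℝ) - wordMap ρ t' v (1 - ρ 2)| ≤ wordRatio ρ v * ρ 2 ^ k := by
        rintro w hw x ⟨y, ⟨q, hq, hqy⟩, hyx⟩
        obtain rfl := Subtype.ext hyx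
        dsimp only at hqy
        rw [← hqy, wordMap_append, abs_wordMap_sub hM.pos]
        exact mul_le_mul_of_nonneg_left
          (abs_wordMap_sub_touching_point h' hkm (h'.subset_Icc hq.1) hw) (hρw v).le
      rintro x (hx | hx)
      · exact key wa (Or.inl rfl) x hx
      · exact key wb (Or.inr rfl) x hx
    have hKM : Ka ∪ Kb ⊆ M := Set.union_subset (pullback_subset _ _) (pullback_subset _ _)
    -- Both pieces are close to one touching point, so a single cylinder w of `M` contains both
    -- preimages. Its weight W is then a common factor of the two contents.
    obtain ⟨w, hKw, hw⟩ := hloc (ε := 2 / c * (wordRatio ρ v * ρ 2 ^ k)) hKM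
      (Set.Nonempty.inl (pullback_nonempty f (wordMap_mem h'.map_mem _ h'.one_mem)
        ⟨1, ⟨h'.one_mem, h'.d_lt_one.le⟩, rfl⟩)) (by positivity) fun x hx y hy => by
          have e₁ := hnear ⟨x, hKM hx⟩ hx
          have e₂ := hnear ⟨y, hKM hy⟩ hy
          refine (hfd ⟨x, hKM hx⟩ ⟨y, hKM hy⟩).trans ?_
          rw [div_le_iff₀ hc]
          have e₃ := abs_sub_le (f ⟨x, hKM hx⟩ : ℝ) (wordMap ρ t' v (1 - ρ 2)) (f ⟨y, hKM hy⟩)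
          rw [abs_sub_comm (wordMap ρ t' v (1 - ρ 2))] at e₃
          have e₄ : 2 / c * (wordRatio ρ v * ρ 2 ^ k) * c = 2 * (wordRatio ρ v * ρ 2 ^ k) := by
            field_simp
          linarith
    -- If f sends one point of a level-D subcylinder into the isolated piece, it sends the whole
    -- subcylinder there, by the choice of D.
    have hval : ∀ w₀ : List (Fin 3), ρ 0 * ρ 1 * ρ 2 * ρ 2 ^ k ≤ wordRatio ρ (w₀ ++ [0]) →
        μ (wordMap ρ t w ⁻¹' pullback f
          (wordMap ρ t' (v ++ (w₀ ++ [0])) '' (M' ∩ Set.Ici (1 - ρ 1 - ρ 2)))) ∈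
          contentValues u D := by
      intro w₀ hw₀
      refine IsSeparatedSelfSimilar.content_mem_contentValues hμ0 hμ1 hμ D ?_
      intro w₁ hw₁ x hx y hy hxK
      obtain ⟨x', ⟨q, hq, hqx⟩, hx'⟩ := hxK
      dsimp only at hqx
      set y' : M := ⟨wordMap ρ t w (wordMap ρ t w₁ y),
        wordMap_mem hM.map_mem w (wordMap_mem hM.map_mem w₁ hy)⟩ with hy'
      refine ⟨y', ?_, rfl⟩
      rw [Set.mem_preimage]
      rw [← List.append_assoc] at hqx ⊢
      refine h'.mem_image_of_abs_sub_lt (v ++ w₀) hq (f y').2 ?_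
      rw [← ht', hqx]
      have d₁ : |(f x' : ℝ) - f y'| ≤ c' * |(x' : ℝ) - y'| := (hf x' y').2
      have d₂ : |(x' : ℝ) - y'| ≤ wordRatio ρ w * β ^ D := by
        rw [hx', hy']
        change |wordMap ρ t w (wordMap ρ t w₁ x) - wordMap ρ t w (wordMap ρ t w₁ y)| ≤ _
        rw [abs_wordMap_sub hM.pos, abs_wordMap_sub hM.pos]
        have e₁ := Real.dist_le_of_mem_Icc_01 (h.subset_Icc hx) (h.subset_Icc hy)
        rw [Real.dist_eq] at e₁
        have e₂ := wordRatio_le_pow hM.pos hβ w₁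
        rw [hw₁] at e₂
        exact mul_le_mul_of_nonneg_left ((mul_le_of_le_one_right (hρw w₁).le e₁).trans e₂)
          (hρw w).le
      have hβD : 0 ≤ β ^ D := pow_nonneg hβ0 D
      calc |(f x' : ℝ) - f y'| ≤ c' * (wordRatio ρ w * β ^ D) := d₁.trans (by gcongr)
        _ ≤ c' * ((2 / (δ * α) * (2 / c * (wordRatio ρ v * ρ 2 ^ k))) * β ^ D) := by gcongr
        _ = β ^ D * (c' * (2 / (δ * α) * (2 / c))) * (wordRatio ρ v * ρ 2 ^ k) := by ring
        _ < g * (wordRatio ρ v * ρ 2 ^ k) := by gcongr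
        _ = (1 - ρ 1 - ρ 2 - ρ 0) * (wordRatio ρ v * (ρ 0 * ρ 1 * ρ 2 * ρ 2 ^ k)) := by
          rw [hg]; ring
        _ ≤ (1 - ρ 1 - ρ 2 - ρ 0) * wordRatio ρ (v ++ w₀ ++ [0]) := by
          rw [List.append_assoc, wordRatio_append]
          exact mul_le_mul_of_nonneg_left (mul_le_mul_of_nonneg_left hw₀ (hρw v).le)
            (sub_nonneg.2 h'.a_lt.le)
    exact ⟨wordRatio u w, wordRatio_pos hupos w, _, hval _ hra, _, hval _ hrb,
      hcyl (Set.subset_union_left.trans hKw), hcyl (Set.subset_union_right.trans hKw)⟩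
  -- pass to the limit along almost extremal words
  have hseq : ∀ n : ℕ, ∃ x ∈ contentValues u D, ∃ y ∈ contentValues u D, ∃ W : ℝ, W ≠ 0 ∧
      |W * x - L * wordRatio u wa| ≤ 1 / ((n : ℝ) + 1) ∧
      |W * y - L * wordRatio u wb| ≤ 1 / ((n : ℝ) + 1) := by
    intro n
    obtain ⟨v, hv⟩ := hprop (1 / ((n : ℝ) + 1)) (by positivity)
    obtain ⟨W, hW, x, hx, y, hy, hxe, hye⟩ := hpattern v
    have huv := wordRatio_pos hupos v
    have key : ∀ z e : ℝ, |W * z - L * wordRatio u v * e| ≤ 1 / ((n : ℝ) + 1) * wordRatio u v →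
        |W / wordRatio u v * z - L * e| ≤ 1 / ((n : ℝ) + 1) := by
      intro z e hz
      have : W / wordRatio u v * z - L * e =
          (W * z - L * wordRatio u v * e) / wordRatio u v := by
        field_simp
      rw [this, abs_div, abs_of_pos huv, div_le_iff₀ huv]
      exact hz
    exact ⟨x, hx, y, hy, W / wordRatio u v, by positivity, key _ _ (hxe ▸ hv wa),
      key _ _ (hye ▸ hv wb)⟩
  choose x hx y hy W hW hWx hWy using hseq
  have lim : ∀ {z : ℕ → ℝ} {l : ℝ}, (∀ n : ℕ, |z n - l| ≤ 1 / ((n : ℝ) + 1)) →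
      Filter.Tendsto z Filter.atTop (nhds l) := fun {z l} hz => by
    rw [tendsto_iff_dist_tendsto_zero]
    exact squeeze_zero (fun _ => dist_nonneg) hz tendsto_one_div_add_atTop_nhds_zero_nat
  have hlim := (lim hWx).div (lim hWy) (mul_pos hL (wordRatio_pos hupos wb)).ne'
  rw [mul_div_mul_left _ _ hL.ne'] at hlim
  -- W cancels in the quotients, which therefore stay in a finite, hence closed, set.
  refine (hfin.image2 _ hfin).isClosed.mem_of_tendsto hlim (Filter.Eventually.of_forall fun n => ?_)
  exact ⟨x n, hx n, y n, hy n, (mul_div_mul_left _ _ (hW n)).symm⟩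

end Necessity

theorem exists_pow_between {a c : ℝ} (ha : 0 < a) (ha1 : a < 1) (hc : 0 < c) (hc1 : c < 1)
    (k : ℕ) : ∃ m : ℕ, a ^ (m + 1) < c ^ k ∧ c ^ k ≤ a ^ m :=
  exists_nat_pow_near_of_lt_one (pow_pos hc k) (pow_le_one₀ hc.le hc1.le) ha ha1

/-- By pigeonhole two exponents k ≠ l give the same quotient; taking logarithms and cancelling s
leaves (k - l) log c = (m k - m l) log a, and m k ≠ m l because log c is nonzero. -/
theorem log_div_log_rational_of_finite {a c A B s : ℝ} (ha : 0 < a) (ha1 : a < 1) (hc : 0 < c)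
    (hc1 : c < 1) (hA : A ≠ 0) (hB : B ≠ 0) (hs : s ≠ 0) {Q : Set ℝ} (hQ : Q.Finite) (m : ℕ → ℕ)
    (hm : ∀ k, A * (c ^ s) ^ k / (B * (a ^ s) ^ m k) ∈ Q) :
    ∃ q : ℚ, Real.log a / Real.log c = q := by
  have : Finite Q := hQ
  obtain ⟨k, l, hkl, heq⟩ := Finite.exists_ne_map_eq_of_infinite
    (fun k : ℕ => (⟨_, hm k⟩ : Q))
  have hla := (Real.log_neg ha ha1).ne
  have hlc := (Real.log_neg hc hc1).ne
  have has : 0 < a ^ s := Real.rpow_pos_of_pos ha s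
  have hcs : 0 < c ^ s := Real.rpow_pos_of_pos hc s
  have h₁ : A * (c ^ s) ^ k / (B * (a ^ s) ^ m k) = A * (c ^ s) ^ l / (B * (a ^ s) ^ m l) :=
    congrArg Subtype.val heq
  rw [div_eq_div_iff (by positivity) (by positivity)] at h₁
  have h₂ : (c ^ s) ^ k * (a ^ s) ^ m l = (c ^ s) ^ l * (a ^ s) ^ m k := by
    have hAB : A * B ≠ 0 := mul_ne_zero hA hB
    refine mul_left_cancel₀ hAB ?_
    linear_combination h₁
  have h₃ := congrArg Real.log h₂
  rw [Real.log_mul (by positivity) (by positivity), Real.log_mul (by positivity) (by positivity),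
    Real.log_pow, Real.log_pow, Real.log_pow, Real.log_pow, Real.log_rpow ha,
    Real.log_rpow hc] at h₃
  have h₄ : ((k : ℝ) - l) * Real.log c = ((m k : ℝ) - m l) * Real.log a := by
    refine mul_left_cancel₀ hs ?_
    linear_combination h₃
  have hkl' : (k : ℝ) - l ≠ 0 := sub_ne_zero.2 (Nat.cast_injective.ne hkl)
  have hml : (m k : ℝ) - m l ≠ 0 := by
    intro h0
    rw [h0, zero_mul] at h₄
    exact mul_ne_zero hkl' hlc h₄
  refine ⟨((k : ℚ) - l) / ((m k : ℚ) - m l), ?_⟩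
  push_cast
  rw [div_eq_div_iff hlc hml]
  linarith

theorem log_div_log_of_lipschitzEquivalent (ρ : Fin 3 → ℝ) (hρ : IsContractionVector ρ)
    (d₂ : ℝ) (hd₂ : ρ 0 < d₂) (hd₂' : d₂ < 1 - ρ 1 - ρ 2)
    (hL : LipschitzEquivalent (separatedSet ρ hρ d₂) (touchingSet ρ hρ)) :
    ∃ q : ℚ, Real.log (ρ 0) / Real.log (ρ 2) = (q : ℝ) := by
  obtain ⟨f, c, hc, c', hc', hf⟩ := hL
  have h := isTernarySet_of_isAttractor (hρ := hρ) hd₂ hd₂'.le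
    (SimilitudeIFS.isAttractor_attractor _)
  have h' := isTernarySet_of_isAttractor (hρ := hρ) (hd₂.trans hd₂') le_rfl
    (SimilitudeIFS.isAttractor_attractor _)
  obtain ⟨s, hs, hsum⟩ := exists_sum_rpow_eq_one hρ.pos hρ.sum_lt_one
  have hs0 : s ≠ 0 := by
    rintro rfl
    norm_num at hsum
  obtain ⟨Q, hQ, hQm⟩ := exists_finite_ratios h (h.isSeparatedSelfSimilar hd₂') h' f hc hc' hf hs
    hsum
  choose m hm hm' using exists_pow_between (hρ.pos 0) (hρ.lt_one 0) (hρ.pos 2) (hρ.lt_one 2)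
  have pos : ∀ i, 0 < ρ i ^ s := fun i => Real.rpow_pos_of_pos (hρ.pos i) s
  refine log_div_log_rational_of_finite (A := ρ 1 ^ s * ρ 0 ^ s) (B := ρ 2 ^ s * ρ 0 ^ s)
    (hρ.pos 0) (hρ.lt_one 0) (hρ.pos 2) (hρ.lt_one 2) (mul_pos (pos 1) (pos 0)).ne'
    (mul_pos (pos 2) (pos 0)).ne' hs0 hQ m fun k => ?_
  have := hQm k (m k) (hm k) (hm' k)
  simp only [wordRatio_append, wordRatio_cons, wordRatio_replicate, wordRatio_nil] at this
  convert this using 1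
  ring

theorem mainTheorem6 (ρ : Fin 3 → ℝ) (hρ : IsContractionVector ρ)
    (d₂ : ℝ) (hd₂ : ρ 0 < d₂) (hd₂' : d₂ < 1 - ρ 1 - ρ 2) :
    LipschitzEquivalent (separatedSet ρ hρ d₂) (touchingSet ρ hρ) ↔
      ∃ q : ℚ, Real.log (ρ 0) / Real.log (ρ 2) = (q : ℝ) :=
  ⟨log_div_log_of_lipschitzEquivalent ρ hρ d₂ hd₂ hd₂',
    fun ⟨_, hq⟩ => lipschitzEquivalent_of_log_div_log ρ hρ d₂ hd₂ hd₂' hq⟩
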